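/- Let $n\ge 1$, let $a<b$ be real numbers, and let $\gamma:[a,b]\to\mathbb{R}^n$ be a curve that is continuous on $[a,b]$ and of class $C^n$ on $(a,b)$. Assume that $\gamma$ has totally positive torsion, i.e. for every $t\in(a,b)$ all leading principal minors of the $n\times n$ matrix $(\gamma'(t),\gamma''(t),\ldots,\gamma^{(n)}(t))$, whose columns are the derivatives of $\gamma$, are positive. Let $\mathrm{Vol}$ denote Lebesgue measure on $\mathbb{R}^n$ and let $\mathrm{conv}$ denote the convex hull. In all formulas below the integrands (defined for almost every $x$) are Lebesgue integrable over the indicated domain. If $n=2\ell$, then \begin{align*} \mathrm{Vol}(\mathrm{conv}(\gamma([a,b]))) &=\frac{(-1)^{\frac{\ell(\ell-1)}{2}}}{(2\ell)!}\int_{a\le x_1\le\ldots\le x_\ell\le b}\det\bigl(\gamma(x_1)-\gamma(a),\ldots,\gamma(x_\ell)-\gamma(a),\gamma'(x_1),\ldots,\gamma'(x_\ell)\bigr)\,dx\\ &=\frac{(-1)^{\frac{\ell(\ell-1)}{2}}}{(2\ell)!}\int_{a\le x_1\le\ldots\le x_\ell\le b}\det\bigl(\gamma(x_1)-\gamma(b),\ldots,\gamma(x_\ell)-\gamma(b),\gamma'(x_1),\ldots,\gamma'(x_\ell)\bigr)\,dx.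 \end{align*} If $n=2\ell-1$, then \begin{align*} &\mathrm{Vol}(\mathrm{conv}(\gamma([a,b])))\\ &=\frac{(-1)^{\frac{(\ell-1)(\ell-2)}{2}}}{(2\ell-1)!}\int_{a\le x_2\le\ldots\le x_\ell\le b}\det\bigl(\gamma(b)-\gamma(a),\gamma(x_2)-\gamma(a),\ldots,\gamma(x_\ell)-\gamma(a),\gamma'(x_2),\ldots,\gamma'(x_\ell)\bigr)\,dx\\ &=\frac{(-1)^{\frac{\ell(\ell-1)}{2}}}{(2\ell-1)!}\int_{a\le x_1\le\ldots\le x_\ell\le b}\det\bigl(\gamma(x_2)-\gamma(x_1),\ldots,\gamma(x_\ell)-\gamma(x_1),\gamma'(x_1),\ldots,\gamma'(x_\ell)\bigr)\,dx. \end{align*} For $\ell=1$ the first of these integrals, over zero variables, is understood as the value $\gamma(b)-\gamma(a)$ of its integrand. -/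

import Mathlib

open MeasureTheory Set

/-- The determinant of the `n × n` matrix whose successive columns are the vectors
`v 0, …, v (k - 1)` of `ℝⁿ`, where `k = n`. -/
noncomputable def detCols {n k : ℕ} (h : k = n) (v : Fin k → (Fin n → ℝ)) : ℝ :=
  Matrix.det (Matrix.of fun i j : Fin n => v (Fin.cast h.symm j) i)

/-- The matrix `(γ'(t), γ''(t), …, γ⁽ⁿ⁾(t))`, with the derivatives as columns. -/
noncomputable def torsionMatrix {n : ℕ} (γ : ℝ → (Fin n → ℝ)) (t : ℝ) :
    Matrix (Fin n) (Fin n) ℝ :=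
  Matrix.of fun i j => iteratedDeriv ((j : ℕ) + 1) γ t i

/-- All leading principal minors of `(γ'(t), …, γ⁽ⁿ⁾(t))` are positive for all `t ∈ (a, b)`. -/
def HasTotallyPositiveTorsion {n : ℕ} (γ : ℝ → (Fin n → ℝ)) (a b : ℝ) : Prop :=
  ∀ t ∈ Ioo a b, ∀ k : ℕ, ∀ hk : k ≤ n,
    0 < ((torsionMatrix γ t).submatrix (Fin.castLE hk) (Fin.castLE hk)).det

/-- The ordered simplex `{x ∈ ℝᵐ : a ≤ x₁ ≤ ⋯ ≤ xₘ ≤ b}`. -/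
def orderedSimplex (a b : ℝ) (m : ℕ) : Set (Fin m → ℝ) :=
  {x | Monotone x ∧ ∀ i, x i ∈ Icc a b}

/-- The columns
`γ(x₁) - γ(r), …, γ(xₘ) - γ(r), γ'(x₁), …, γ'(xₘ)`. -/
noncomputable def chordTangent {n m : ℕ} (γ : ℝ → (Fin n → ℝ)) (r : ℝ) (x : Fin m → ℝ) :
    Fin (m + m) → (Fin n → ℝ) :=
  Fin.append (fun i => γ (x i) - γ r) (fun i => deriv γ (x i))

/-- The columns
`γ(b) - γ(a), γ(x₁) - γ(a), …, γ(xₘ) - γ(a), γ'(x₁), …, γ'(xₘ)`. -/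
noncomputable def endsChordTangent {n m : ℕ} (γ : ℝ → (Fin n → ℝ)) (a b : ℝ) (x : Fin m → ℝ) :
    Fin (m + m + 1) → (Fin n → ℝ) :=
  Fin.cons (γ b - γ a) (chordTangent γ a x)

/-- The columns
`γ(x₂) - γ(x₁), …, γ(xₘ₊₁) - γ(x₁), γ'(x₁), …, γ'(xₘ₊₁)`. -/
noncomputable def firstChordTangent {n m : ℕ} (γ : ℝ → (Fin n → ℝ)) (x : Fin (m + 1) → ℝ) :
    Fin (m + (m + 1)) → (Fin n → ℝ) :=
  Fin.append (fun i : Fin m => γ (x i.succ) - γ (x 0)) (fun i => deriv γ (x i))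

/-! Lift the curve to height one in ℝⁿ⁺¹ and parametrise the cone over the convex hull K. Fix p
parameters e among the endpoints and k moving parameters x₁ < … < xₖ in (a, b), with p + 2k = n + 1,
and send positive weights c together with x to ∑ c(q)·(1, γ(q)), summed over the parameters in e and
x. This is a bijection onto the interior of the cone (`coneMap_image`, `injOn_coneMap`). Its
Jacobian is the product of the weights at the moving points times the determinant with columns (1,
γ(eᵢ)), (1, γ(xⱼ)), (0, γ'(xⱼ)).

Integrate exp(-y₀) over the cone. Slicing by height gives n!·Vol(K). In the parameters, y₀ is the
sum of the weights, so the integrand factors; each weight integral is ∫ e^{-s} ds = 1 or ∫ s e^{-s}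
ds = 1, and what remains is the integral of the absolute value of the confluent determinant. Its
sign is constant on the simplex (`confluentDet_mul_pos`). The cases p = 1 (e = a or e = b), p = 2
and p = 0 yield the four formulas after eliminating the first column.

Torsion enters through positivity. The leading minors are Wronskians of the components of γ', and
dividing successively by the first function turns them into positive determinants det(γ'(s₁), …,
γ'(s_w)) at increasing parameters, for every projection to the first w coordinates. Hence any n + 1
distinct points of the curve are affinely independent, which gives injectivity. Affine functions
also have few zeros counted with multiplicity, so sparse sets of parameters lie on supporting
hyperplanes; such points of the cone are on its boundary, which gives surjectivity. -/

/-! ### Homogeneous coordinates and the columnwise mean value theorem. -/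

/-- The point `(1, v)` of `ℝᵐ⁺¹`. -/
def homCoord {m : ℕ} (v : Fin m → ℝ) : Fin (m + 1) → ℝ := Fin.cons 1 v

/-- The direction `(0, v)` of `ℝᵐ⁺¹`. -/
def homDir {m : ℕ} (v : Fin m → ℝ) : Fin (m + 1) → ℝ := Fin.cons 0 v

@[simp] lemma homCoord_zero {m : ℕ} (v : Fin m → ℝ) : homCoord v 0 = 1 := rfl

@[simp] lemma homCoord_succ {m : ℕ} (v : Fin m → ℝ) (i : Fin m) : homCoord v i.succ = v i := rfl

@[simp] lemma homDir_zero {m : ℕ} (v : Fin m → ℝ) : homDir v 0 = 0 := rfl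

@[simp] lemma homDir_succ {m : ℕ} (v : Fin m → ℝ) (i : Fin m) : homDir v i.succ = v i := rfl

lemma det_eq_of_row_zero_eq_single {m : ℕ} (B : Matrix (Fin (m + 1)) (Fin (m + 1)) ℝ)
    (h0 : B 0 0 = 1) (hs : ∀ j : Fin m, B 0 j.succ = 0) :
    B.det = (Matrix.of fun i j : Fin m => B i.succ j.succ).det := by
  rw [Matrix.det_succ_row_zero, Fin.sum_univ_succ]
  simp [h0, hs]
  rfl

/-- Subtracting from each column its predecessor turns the row of ones into (1, 0, …, 0). -/
lemma det_homCoord_eq_det_sub {m : ℕ} (w : Fin (m + 1) → Fin m → ℝ) :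
    (Matrix.of fun i j => homCoord (w j) i).det =
      (Matrix.of fun i j : Fin m => w j.succ i - w j.castSucc i).det := by
  let A : Matrix (Fin (m + 1)) (Fin (m + 1)) ℝ := Matrix.of fun i j => homCoord (w j) i
  let B : Matrix (Fin (m + 1)) (Fin (m + 1)) ℝ :=
    Matrix.of fun i j => Fin.cases (A i 0) (fun j' => A i j'.succ - A i j'.castSucc) j
  have hAB : A.det = B.det :=
    Matrix.det_eq_of_forall_col_eq_smul_add_pred (fun _ => 1) (fun i => by simp [B])
      (fun i j => by simp [B])
  change A.det = _
  rw [hAB, det_eq_of_row_zero_eq_single B (by simp [B, A]) (by simp [B, A])]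
  rfl

/-- Columnwise mean value theorem: positivity of the determinants of derivatives passes to the
determinants of the curve in homogeneous coordinates. -/
lemma det_homCoord_pos_of_deriv {m : ℕ} (v : ℝ → Fin m → ℝ) (y : Fin (m + 1) → ℝ)
    (hy : StrictMono y)
    (hc : ContinuousOn v (Icc (y 0) (y (Fin.last m))))
    (hd : ∀ t ∈ Ioo (y 0) (y (Fin.last m)), DifferentiableAt ℝ v t)
    (hpos : ∀ s : Fin m → ℝ, StrictMono s → (∀ j, s j ∈ Ioo (y 0) (y (Fin.last m))) →
      0 < (Matrix.of fun i j => deriv v (s j) i).det) :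
    0 < (Matrix.of fun i j => homCoord (v (y j)) i).det := by
  rw [det_homCoord_eq_det_sub (fun j => v (y j))]
  -- The last r columns are chords, the others tangents taken at arbitrary points of their own gaps.
  -- The determinant is linear in the column q being converted, so the scalar mean value theorem
  -- exchanges that chord for a tangent at an unspecified point; this is why s is universally
  -- quantified.
  have key : ∀ r : ℕ, r ≤ m → ∀ s : Fin m → ℝ, (∀ j, s j ∈ Ioo (y j.castSucc) (y j.succ)) →
      0 < (Matrix.of fun i j : Fin m => if (j : ℕ) < m - r then deriv v (s j) i
        else v (y j.succ) i - v (y j.castSucc) i).det := by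
    intro r
    induction r with
    | zero =>
      intro _ s hs
      simp only [tsub_zero, Fin.is_lt, if_true]
      apply hpos s
      · intro i j hij
        have h1 : y i.succ ≤ y j.castSucc := hy.monotone (by
          rw [Fin.le_def]; simpa using hij)
        linarith [(hs i).2, (hs j).1]
      · intro j
        exact ⟨lt_of_le_of_lt (hy.monotone (Fin.zero_le _)) (hs j).1,
          lt_of_lt_of_le (hs j).2 (hy.monotone (Fin.le_last _))⟩
    | succ r ih =>
      intro hr s hs
      let q : Fin m := ⟨m - (r + 1), by omega⟩
      have hq : (q : ℕ) = m - (r + 1) := rfl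
      set A : Matrix (Fin m) (Fin m) ℝ := Matrix.of fun i j : Fin m =>
        if (j : ℕ) < m - (r + 1) then deriv v (s j) i
          else v (y j.succ) i - v (y j.castSucc) i with hA
      let L : (Fin m → ℝ) →ₗ[ℝ] ℝ := (LinearMap.proj q).comp (Matrix.cramer A)
      have hL : ∀ w, L w = (A.updateCol q w).det := fun w => Matrix.cramer_apply A w q
      let Lc : (Fin m → ℝ) →L[ℝ] ℝ := LinearMap.toContinuousLinearMap L
      have hlt : y q.castSucc < y q.succ := hy (Fin.castSucc_lt_succ)
      have hsub : Icc (y q.castSucc) (y q.succ) ⊆ Icc (y 0) (y (Fin.last m)) :=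
        Icc_subset_Icc (hy.monotone (Fin.zero_le _)) (hy.monotone (Fin.le_last _))
      have hsub' : Ioo (y q.castSucc) (y q.succ) ⊆ Ioo (y 0) (y (Fin.last m)) :=
        Ioo_subset_Ioo (hy.monotone (Fin.zero_le _)) (hy.monotone (Fin.le_last _))
      obtain ⟨c, hc1, hc2⟩ := exists_hasDerivAt_eq_slope (fun t => Lc (v t))
        (fun t => Lc (deriv v t)) hlt (Lc.continuous.comp_continuousOn (hc.mono hsub))
        (fun t ht => Lc.hasFDerivAt.comp_hasDerivAt t (hd t (hsub' ht)).hasDerivAt)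
      have h1 : A.det = L (v (y q.succ) - v (y q.castSucc)) := by
        rw [hL]
        congr 1
        ext i j
        by_cases hj : j = q
        · subst hj; simp [hA, hq]
        · simp [hj]
      have h2 : 0 < L (deriv v c) := by
        rw [hL]
        have := ih (by omega) (Function.update s q c) (by
          intro j
          by_cases hj : j = q
          · subst hj; simpa using hc1
          · simpa [hj] using hs j)
        convert this using 2
        ext i j
        by_cases hj : j = q
        · subst hj
          have : (q : ℕ) < m - r := by omega
          simp [this]
        · have hj' : (j : ℕ) ≠ q := fun h => hj (Fin.ext h)
          have : ((j : ℕ) < m - r) ↔ ((j : ℕ) < m - (r + 1)) := by omega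
          simp [hj, hA, this]
      rw [h1, map_sub]
      have h3 : L (deriv v c) = (L (v (y q.succ)) - L (v (y q.castSucc))) /
        (y q.succ - y q.castSucc) := hc2
      rw [h3] at h2
      have := mul_pos h2 (sub_pos.2 hlt)
      rwa [div_mul_cancel₀ _ (sub_pos.2 hlt).ne'] at this
  have := key m le_rfl (fun j => (y j.castSucc + y j.succ) / 2) (fun j => by
    have := hy (Fin.castSucc_lt_succ (i := j))
    constructor <;> linarith)
  simpa using this

/-! ### Wronskians and collocation determinants. -/

/-- By Leibniz's rule, multiplying all functions by g multiplies the Wronskian matrix by a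
triangular matrix with diagonal entries g(t). -/
lemma det_iteratedDeriv_mul {k : ℕ} (f : Fin k → ℝ → ℝ) (g : ℝ → ℝ) (t : ℝ)
    (hf : ∀ i, ContDiffAt ℝ (k - 1 : ℕ) (f i) t) (hg : ContDiffAt ℝ (k - 1 : ℕ) g t) :
    (Matrix.of fun i j : Fin k => iteratedDeriv j (f i * g) t).det =
      g t ^ k * (Matrix.of fun i j : Fin k => iteratedDeriv j (f i) t).det := by
  let T : Matrix (Fin k) (Fin k) ℝ :=
    Matrix.of fun l j => ((j : ℕ).choose l : ℝ) * iteratedDeriv ((j : ℕ) - l) g t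
  have hT : T.det = g t ^ k := by
    rw [Matrix.det_of_isUpperTriangular]
    · simp [T]
    · intro i j hij
      simp only [T, Matrix.of_apply]
      rw [Nat.choose_eq_zero_of_lt (by simpa using hij)]
      simp
  have hM : (Matrix.of fun i j : Fin k => iteratedDeriv j (f i * g) t) =
      (Matrix.of fun i j : Fin k => iteratedDeriv j (f i) t) * T := by
    ext i j
    have hj : ((j : ℕ) : WithTop ℕ∞) ≤ ((k - 1 : ℕ) : WithTop ℕ∞) := by
      have := j.2
      exact_mod_cast (show (j : ℕ) ≤ k - 1 by omega)
    rw [Matrix.of_apply, iteratedDeriv_mul ((hf i).of_le hj) (hg.of_le hj), Matrix.mul_apply]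
    simp only [Matrix.of_apply, T]
    rw [Fin.sum_univ_eq_sum_range (fun l => iteratedDeriv l (f i) t *
      (((j : ℕ).choose l : ℝ) * iteratedDeriv ((j : ℕ) - l) g t)) k]
    have hsub : Finset.range ((j : ℕ) + 1) ⊆ Finset.range k :=
      Finset.range_mono j.2
    rw [← Finset.sum_subset hsub]
    · exact Finset.sum_congr rfl fun l _ => by ring
    · intro l _ hl
      rw [Nat.choose_eq_zero_of_lt (by simpa using hl)]
      simp
  rw [hM, Matrix.det_mul, hT, mul_comm]

/-- Reduction of a Wronskian by its first function. -/
lemma wronskian_succ {k : ℕ} {a b : ℝ} (u : ℕ → ℝ → ℝ)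
    (hu : ∀ i ≤ k, ContDiffOn ℝ k (u i) (Ioo a b)) (h0 : ∀ t ∈ Ioo a b, u 0 t ≠ 0)
    {t : ℝ} (ht : t ∈ Ioo a b) :
    (Matrix.of fun i j : Fin (k + 1) => iteratedDeriv j (u i) t).det =
      u 0 t ^ (k + 1) * (Matrix.of fun i j : Fin k =>
        iteratedDeriv j (deriv (fun x => u (i + 1) x / u 0 x)) t).det := by
  -- After division by u 0 the first function is 1, so the first row of the Wronskian matrix is (1,
  -- 0, …, 0).
  let f : Fin (k + 1) → ℝ → ℝ := fun i x => Fin.cases 1 (fun i' : Fin k => u (i' + 1) x / u 0 x) i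
  have hnhds : Ioo a b ∈ nhds t := isOpen_Ioo.mem_nhds ht
  have hcd : ∀ i ≤ k, ContDiffAt ℝ (k : ℕ) (u i) t := fun i hi => (hu i hi).contDiffAt hnhds
  have hf : ∀ i, ContDiffAt ℝ (k + 1 - 1 : ℕ) (f i) t := by
    intro i
    refine Fin.cases ?_ (fun i' => ?_) i
    · exact contDiffAt_const
    · exact (hcd _ i'.2).div (hcd 0 (Nat.zero_le _)) (h0 t ht)
  have h1 : ∀ i j : Fin (k + 1), iteratedDeriv j (u i) t = iteratedDeriv j (f i * u 0) t := by
    intro i j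
    refine (Filter.EventuallyEq.iteratedDeriv_eq _ ?_)
    filter_upwards [hnhds] with x hx
    refine Fin.cases ?_ (fun i' => ?_) i
    · simp [f]
    · simp [f, h0 x hx]
  simp only [h1]
  rw [det_iteratedDeriv_mul f (u 0) t hf (hcd 0 (Nat.zero_le _))]
  congr 1
  rw [det_eq_of_row_zero_eq_single]
  · congr 1
    ext i j
    simp only [Matrix.of_apply, Fin.val_succ, iteratedDeriv_succ']
    rfl
  · simp [f]
  · intro j
    have := iteratedDeriv_const (n := (j : ℕ) + 1) (c := (1 : ℝ)) (x := t)
    simpa [f] using this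

lemma contDiffOn_deriv_Ioo {a b : ℝ} {f : ℝ → ℝ} {k : ℕ} (hf : ContDiffOn ℝ (k + 1 : ℕ) f (Ioo a b)) :
    ContDiffOn ℝ k (deriv f) (Ioo a b) :=
  hf.deriv_of_isOpen isOpen_Ioo (by norm_cast)

/-- Functions on an open interval with positive Wronskians have positive collocation
determinants. -/
theorem det_pos_of_wronskian_pos (m : ℕ) {a b : ℝ} (u : ℕ → ℝ → ℝ)
    (hu : ∀ i < m, ContDiffOn ℝ (m - 1 : ℕ) (u i) (Ioo a b))
    (hW : ∀ k ≤ m, ∀ t ∈ Ioo a b,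
      0 < (Matrix.of fun i j : Fin k => iteratedDeriv j (u i) t).det)
    (s : Fin m → ℝ) (hs : StrictMono s) (hsI : ∀ j, s j ∈ Ioo a b) :
    0 < (Matrix.of fun i j : Fin m => u i (s j)).det := by
  induction m generalizing u with
  | zero => simp
  | succ m ih =>
    simp only [Nat.add_sub_cancel] at hu
    have h0 : ∀ t ∈ Ioo a b, 0 < u 0 t := by
      intro t ht
      simpa using hW 1 (by omega) t ht
    -- Dividing column j by u 0 (s j) > 0 makes the collocation matrix one of points (1, v). The
    -- mean value theorem reduces it to the derivatives of the quotients, whose Wronskians are again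
    -- positive, so induction applies.
    let v : ℝ → Fin m → ℝ := fun x i => u (i + 1) x / u 0 x
    have hq : ∀ i : ℕ, i < m → ContDiffOn ℝ m (fun x => u (i + 1) x / u 0 x) (Ioo a b) :=
      fun i hi => (hu _ (by omega)).div (hu 0 (by omega)) fun t ht => (h0 t ht).ne'
    have hdet : ∀ σ : Fin m → ℝ, StrictMono σ → (∀ j, σ j ∈ Ioo a b) →
        0 < (Matrix.of fun i j : Fin m => deriv (fun x => u (i + 1) x / u 0 x) (σ j)).det := by
      intro σ hσ hσI
      refine ih (fun i => deriv (fun x => u (i + 1) x / u 0 x)) ?_ ?_ σ hσ hσI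
      · intro i hi
        obtain ⟨m', rfl⟩ : ∃ m', m = m' + 1 := ⟨m - 1, by omega⟩
        exact contDiffOn_deriv_Ioo (hq i hi)
      · intro k hk t ht
        have h1 := hW (k + 1) (by omega) t ht
        rw [wronskian_succ u (fun i hi => (hu i (by omega)).of_le (by exact_mod_cast hk))
          (fun t ht => (h0 t ht).ne') ht] at h1
        exact (pos_iff_pos_of_mul_pos h1).1 (pow_pos (h0 t ht) _)
    have hIcc : Icc (s 0) (s (Fin.last m)) ⊆ Ioo a b := fun t ht =>
      ⟨lt_of_lt_of_le (hsI 0).1 ht.1, lt_of_le_of_lt ht.2 (hsI _).2⟩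
    have hIoo : Ioo (s 0) (s (Fin.last m)) ⊆ Ioo a b := Ioo_subset_Icc_self.trans hIcc
    have hdiff : ∀ (i : Fin m), ∀ t ∈ Ioo a b,
        DifferentiableAt ℝ (fun x => u (i + 1) x / u 0 x) t := fun i t ht =>
      ((hq i i.2).contDiffAt (isOpen_Ioo.mem_nhds ht)).differentiableAt (by
        have := i.2
        exact_mod_cast (show m ≠ 0 by omega))
    have h1 : 0 < (Matrix.of fun i j => homCoord (v (s j)) i).det := by
      refine det_homCoord_pos_of_deriv v s hs ?_ ?_ ?_
      · exact continuousOn_pi.2 fun i => (hq i i.2).continuousOn.mono hIcc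
      · exact fun t ht => differentiableAt_pi.2 fun i => hdiff i t (hIoo ht)
      · intro σ hσ hσI
        have := hdet σ hσ fun j => hIoo (hσI j)
        convert this using 4
        ext j
        rw [deriv_pi fun i => hdiff i _ (hIoo (hσI j))]
    have h2 : (Matrix.of fun i j : Fin (m + 1) => u i (s j)) =
        Matrix.of fun i j => u 0 (s j) * (Matrix.of fun i j => homCoord (v (s j)) i) i j := by
      ext i j
      have := (h0 _ (hsI j)).ne'
      refine Fin.cases ?_ (fun i' => ?_) i
      · simp
      · simp [v]; field_simp
    rw [h2, Matrix.det_mul_row]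
    exact mul_pos (Finset.prod_pos fun j _ => h0 _ (hsI j)) h1

lemma iteratedDeriv_apply_pi {n k : ℕ} {γ : ℝ → Fin n → ℝ} {t : ℝ} (h : ContDiffAt ℝ k γ t)
    (i : Fin n) : iteratedDeriv k γ t i = iteratedDeriv k (fun x => γ x i) t := by
  have := (ContinuousLinearMap.proj (R := ℝ) (φ := fun _ : Fin n => ℝ) i).iteratedFDeriv_comp_left
    h le_rfl
  simp only [iteratedDeriv_eq_iteratedFDeriv]
  exact (congrArg (fun M => M fun _ => (1 : ℝ)) this).symm

/-- The leading minors of the torsion matrix are the Wronskians of the first components of γ'. -/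
theorem HasTotallyPositiveTorsion.det_deriv_pos {n : ℕ} {γ : ℝ → Fin n → ℝ} {a b : ℝ}
    (hdiff : ContDiffOn ℝ n γ (Ioo a b)) (h : HasTotallyPositiveTorsion γ a b) {w : ℕ}
    (hw : w ≤ n) (s : Fin w → ℝ) (hs : StrictMono s) (hsI : ∀ j, s j ∈ Ioo a b) :
    0 < (Matrix.of fun i j : Fin w => deriv γ (s j) (Fin.castLE hw i)).det := by
  let u : ℕ → ℝ → ℝ := fun i => if hi : i < n then deriv (fun x => γ x ⟨i, hi⟩) else 0
  have hcomp : ∀ i, ContDiffOn ℝ n (fun x => γ x i) (Ioo a b) := contDiffOn_pi.1 hdiff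
  have hcd : ∀ t ∈ Ioo a b, ContDiffAt ℝ n γ t := fun t ht =>
    hdiff.contDiffAt (isOpen_Ioo.mem_nhds ht)
  have := det_pos_of_wronskian_pos w (a := a) (b := b) u ?_ ?_ s hs hsI
  · convert this using 2
    ext i j
    have hi : (i : ℕ) < n := lt_of_lt_of_le i.2 hw
    have hn : n ≠ 0 := by omega
    simp only [u, hi, dif_pos, Matrix.of_apply]
    have hd : ∀ i, DifferentiableAt ℝ (fun x => γ x i) (s j) := fun i =>
      ((hcomp i).contDiffAt (isOpen_Ioo.mem_nhds (hsI j))).differentiableAt (by exact_mod_cast hn)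
    rw [deriv_pi hd]
    rfl
  · intro i hi
    have hi' : i < n := by omega
    simp only [u, hi', dif_pos]
    refine contDiffOn_deriv_Ioo ((hcomp _).of_le ?_)
    exact_mod_cast (show w - 1 + 1 ≤ n by omega)
  · intro k hk t ht
    have := h t ht k (hk.trans hw)
    convert this using 2
    ext i j
    have hi : (i : ℕ) < n := by omega
    simp only [u, hi, dif_pos, Matrix.submatrix_apply, torsionMatrix, Matrix.of_apply, Fin.val_castLE]
    rw [iteratedDeriv_apply_pi ((hcd t ht).of_le (by
      have := j.2
      exact_mod_cast (show (j : ℕ) + 1 ≤ n by omega))), iteratedDeriv_succ']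
    rfl

/-! ### Positive curves and the orientation of their points. -/

/-- A curve, continuous on `[a, b]` and differentiable on `(a, b)`, whose tangent vectors at
increasing parameters form a positively oriented basis. -/
structure IsPosCurve {n : ℕ} (γ : ℝ → Fin n → ℝ) (a b : ℝ) : Prop where
  continuousOn : ContinuousOn γ (Icc a b)
  differentiableAt : ∀ t ∈ Ioo a b, DifferentiableAt ℝ γ t
  det_pos : ∀ s : Fin n → ℝ, StrictMono s → (∀ j, s j ∈ Ioo a b) →
    0 < (Matrix.of fun i j => deriv γ (s j) i).det

namespace IsPosCurve

variable {n : ℕ} {γ : ℝ → Fin n → ℝ} {a b : ℝ}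

lemma det_homCoord_pos (hγ : IsPosCurve γ a b) (y : Fin (n + 1) → ℝ) (hy : StrictMono y)
    (hyI : ∀ j, y j ∈ Icc a b) : 0 < (Matrix.of fun i j => homCoord (γ (y j)) i).det := by
  have hIcc : Icc (y 0) (y (Fin.last n)) ⊆ Icc a b := Icc_subset_Icc (hyI 0).1 (hyI _).2
  have hIoo : Ioo (y 0) (y (Fin.last n)) ⊆ Ioo a b := Ioo_subset_Ioo (hyI 0).1 (hyI _).2
  exact det_homCoord_pos_of_deriv γ y hy (hγ.continuousOn.mono hIcc)
    (fun t ht => hγ.differentiableAt t (hIoo ht))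
    (fun s hs hsI => hγ.det_pos s hs fun j => hIoo (hsI j))

/-- Sorting the parameters changes both determinants by the same sign, so the Vandermonde
determinant records the orientation of unsorted points. -/
lemma det_homCoord_mul_vandermonde_pos (hγ : IsPosCurve γ a b) (y : Fin (n + 1) → ℝ)
    (hy : Function.Injective y) (hyI : ∀ j, y j ∈ Icc a b) :
    0 < (Matrix.of fun i j => homCoord (γ (y j)) i).det * (Matrix.vandermonde y).det := by
  let σ := Tuple.sort y
  have hmono : StrictMono (y ∘ σ) :=
    (Tuple.monotone_sort y).strictMono_of_injective (hy.comp σ.injective)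
  have h1 := hγ.det_homCoord_pos (y ∘ σ) hmono fun j => hyI _
  have h2 : 0 < (Matrix.vandermonde (y ∘ σ)).det := by
    rw [Matrix.det_vandermonde]
    exact Finset.prod_pos fun i _ => Finset.prod_pos fun j hj =>
      sub_pos.2 (hmono (Finset.mem_Ioi.1 hj))
  have e1 := Matrix.det_permute' σ (Matrix.of fun i j => homCoord (γ (y j)) i)
  have e2 := Matrix.det_permute σ (Matrix.vandermonde y)
  have h3 : (Matrix.of fun i j => homCoord (γ ((y ∘ σ) j)) i).det * (Matrix.vandermonde (y ∘ σ)).det =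
      (Matrix.of fun i j => homCoord (γ (y j)) i).det * (Matrix.vandermonde y).det := by
    have e1' : (Matrix.of fun i j => homCoord (γ ((y ∘ σ) j)) i).det =
      ((Matrix.of fun i j => homCoord (γ (y j)) i).submatrix id σ).det := rfl
    have e2' : (Matrix.vandermonde (y ∘ σ)).det = ((Matrix.vandermonde y).submatrix σ id).det := rfl
    rw [e1', e2', e1, e2]
    have : ((Equiv.Perm.sign σ : ℤ) : ℝ) * ((Equiv.Perm.sign σ : ℤ) : ℝ) = 1 := by
      rcases Int.units_eq_one_or (Equiv.Perm.sign σ) with h | h <;> simp [h]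
    linear_combination ((Matrix.of fun i j => homCoord (γ (y j)) i).det *
      (Matrix.vandermonde y).det) * this
  rw [← h3]
  exact mul_pos h1 h2

lemma hasDerivAt_sum_homCoord (hγ : IsPosCurve γ a b) (c : Fin (n + 1) → ℝ) {t : ℝ}
    (ht : t ∈ Ioo a b) :
    HasDerivAt (fun t => ∑ i, c i * homCoord (γ t) i) (∑ i, c i * homDir (deriv γ t) i) t := by
  simp only [Fin.sum_univ_succ, homCoord_zero, homDir_zero, homCoord_succ, homDir_succ]
  have h := hasDerivAt_pi.1 (hγ.differentiableAt t ht).hasDerivAt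
  have := (HasDerivAt.fun_sum fun (i : Fin n) (_ : i ∈ Finset.univ) =>
    (h i).const_mul (c i.succ)).const_add (c 0 * 1)
  simpa using this

lemma continuousOn_homCoord (hγ : IsPosCurve γ a b) :
    ContinuousOn (fun t => homCoord (γ t)) (Icc a b) := by
  refine continuousOn_pi.2 fun i => ?_
  refine Fin.cases ?_ (fun i => ?_) i
  · exact continuousOn_const
  · exact continuousOn_pi.1 hγ.continuousOn i

end IsPosCurve

/-! ### Counting zeros of affine functions on the curve. -/

/-- Rolle's theorem for a finite set of zeros. -/
lemma exists_finset_deriv_eq_zero {f f' : ℝ → ℝ} {a b : ℝ} (hc : ContinuousOn f (Icc a b))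
    (hd : ∀ t ∈ Ioo a b, HasDerivAt f (f' t) t) (Z : Finset ℝ) (hZ : ∀ z ∈ Z, z ∈ Icc a b)
    (hf : ∀ z ∈ Z, f z = 0) :
    ∃ S : Finset ℝ, (∀ s ∈ S, s ∈ Ioo a b ∧ f' s = 0) ∧ Disjoint S Z ∧ Z.card ≤ S.card + 1 := by
  obtain ⟨N, hN⟩ : ∃ N, N = Z.card - 1 := ⟨_, rfl⟩
  rcases Nat.eq_zero_or_pos Z.card with h0 | h0
  · exact ⟨∅, by simp, by simp, by omega⟩
  have hcard : Z.card = N + 1 := by omega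
  let y := Z.orderEmbOfFin hcard
  have hyZ : ∀ i, y i ∈ Z := fun i => Z.orderEmbOfFin_mem hcard i
  have hR : ∀ i : Fin N, ∃ s ∈ Ioo (y i.castSucc) (y i.succ), f' s = 0 := by
    intro i
    refine exists_hasDerivAt_eq_zero (f := f) (y.strictMono Fin.castSucc_lt_succ) ?_ ?_ ?_
    · exact hc.mono (Icc_subset_Icc (hZ _ (hyZ _)).1 (hZ _ (hyZ _)).2)
    · rw [hf _ (hyZ _), hf _ (hyZ _)]
    · exact fun t ht => hd t (Ioo_subset_Ioo (hZ _ (hyZ _)).1 (hZ _ (hyZ _)).2 ht)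
  choose s hs hs0 using hR
  have hinj : StrictMono s := by
    intro i j hij
    have h1 : y i.succ ≤ y j.castSucc := y.monotone (by rw [Fin.le_def]; simpa using hij)
    linarith [(hs i).2, (hs j).1]
  refine ⟨Finset.univ.image s, ?_, ?_, ?_⟩
  · intro t ht
    obtain ⟨i, -, rfl⟩ := Finset.mem_image.1 ht
    exact ⟨Ioo_subset_Ioo (hZ _ (hyZ _)).1 (hZ _ (hyZ _)).2 (hs i), hs0 i⟩
  -- Rolle points lie strictly between consecutive elements of Z. Disjointness later allows double
  -- zeros to be added without counting a parameter twice.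
  · rw [Finset.disjoint_left]
    intro t ht htZ
    obtain ⟨i, -, rfl⟩ := Finset.mem_image.1 ht
    have : s i ∈ Set.range y := by
      rw [Finset.range_orderEmbOfFin]; exact htZ
    obtain ⟨j, hj⟩ := this
    have h1 := (hs i).1
    have h2 := (hs i).2
    rw [← hj] at h1 h2
    have h1' := y.lt_iff_lt.1 h1
    have h2' := y.lt_iff_lt.1 h2
    rw [Fin.lt_def] at h1' h2'
    simp at h1' h2'
    omega
  · rw [Finset.card_image_of_injective _ hinj.injective]
    simp [hcard]

namespace IsPosCurve

variable {n : ℕ} {γ : ℝ → Fin n → ℝ} {a b : ℝ}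

/-- A nonzero affine function has at most `n` zeros on the curve, counted with multiplicity two
at the parameters in `X`. -/
lemma eq_zero_of_zeros (hγ : IsPosCurve γ a b) (c : Fin (n + 1) → ℝ) (Z X : Finset ℝ)
    (hZ : ∀ z ∈ Z, z ∈ Icc a b) (hX : ∀ x ∈ X, x ∈ Ioo a b) (hXZ : X ⊆ Z)
    (hcard : n + 1 ≤ Z.card + X.card)
    (hz : ∀ z ∈ Z, ∑ i, c i * homCoord (γ z) i = 0)
    (hx : ∀ x ∈ X, ∑ i, c i * homDir (deriv γ x) i = 0) : c = 0 := by
  have hcont : ContinuousOn (fun t => ∑ i, c i * homCoord (γ t) i) (Icc a b) :=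
    continuousOn_finsetSum _ fun i _ =>
      continuousOn_const.mul (continuousOn_pi.1 hγ.continuousOn_homCoord i)
  obtain ⟨S, hS, hdisj, hSc⟩ := exists_finset_deriv_eq_zero hcont
    (fun t ht => hγ.hasDerivAt_sum_homCoord c ht) Z hZ hz
  -- Rolle zeros and double zeros together give n distinct zeros of the derivative. The tangents
  -- there are independent, so the linear part vanishes; a single zero then kills the constant.
  have hdisj' : Disjoint S X := hdisj.mono_right hXZ
  have hcU : n ≤ (S ∪ X).card := by
    rw [Finset.card_union_of_disjoint hdisj']; omega
  obtain ⟨Y, hY, hYc⟩ := Finset.exists_subset_card_eq hcU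
  have hY0 : ∀ y ∈ Y, y ∈ Ioo a b ∧ ∑ i, c i * homDir (deriv γ y) i = 0 := by
    intro y hy
    rcases Finset.mem_union.1 (hY hy) with h | h
    · exact hS y h
    · exact ⟨hX y h, hx y h⟩
  let s := Y.orderEmbOfFin hYc
  have hsY : ∀ i, s i ∈ Y := fun i => Y.orderEmbOfFin_mem hYc i
  have hdet := hγ.det_pos s s.strictMono fun j => (hY0 _ (hsY j)).1
  have htail : (fun i : Fin n => c i.succ) = 0 := by
    refine Matrix.eq_zero_of_vecMul_eq_zero hdet.ne' ?_
    ext j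
    have := (hY0 _ (hsY j)).2
    simp only [Fin.sum_univ_succ, homDir_zero, homDir_succ, mul_zero, zero_add] at this
    simpa [Matrix.vecMul, dotProduct] using this
  have hZne : Z.Nonempty := by
    rw [Finset.nonempty_iff_ne_empty]
    rintro rfl
    have := Finset.subset_empty.1 hXZ
    subst this
    simp at hcard
  obtain ⟨z, hzZ⟩ := hZne
  have h0 := hz z hzZ
  have ht : ∀ i : Fin n, c i.succ = 0 := fun i => congrFun htail i
  simp only [Fin.sum_univ_succ, homCoord_zero, homCoord_succ, ht] at h0
  ext i
  refine Fin.cases ?_ (fun i => ?_) i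
  · simpa using h0
  · exact ht i

end IsPosCurve

/-! ### Confluent determinants and their sign. -/

/-- The lexicographic enumeration of three consecutive blocks. -/
def blockEquiv {p k N : ℕ} (h : p + k + k = N) : (Fin p ⊕ Fin k) ⊕ Fin k ≃ Fin N :=
  ((Equiv.sumCongr finSumFinEquiv (Equiv.refl _)).trans finSumFinEquiv).trans (finCongr h)

lemma prod_prod_Ioi_eq_ite {N : ℕ} (f : Fin N → Fin N → ℝ) :
    ∏ i, ∏ j ∈ Finset.Ioi i, f i j = ∏ i, ∏ j, if i < j then f i j else 1 := by
  refine Finset.prod_congr rfl fun i _ => ?_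
  rw [← Finset.prod_filter]
  congr 1
  ext j
  simp

lemma det_vandermonde_blocks {p k N : ℕ} (h : p + k + k = N) (e : Fin p → ℝ) (x z : Fin k → ℝ) :
    (Matrix.vandermonde (Sum.elim (Sum.elim e x) z ∘ (blockEquiv h).symm)).det =
      (Matrix.vandermonde e).det * (∏ i, ∏ j, (x j - e i)) * (Matrix.vandermonde x).det *
      (∏ i, ∏ j, (z j - e i)) * (∏ i, ∏ j, (z j - x i)) * (Matrix.vandermonde z).det := by
  subst h
  simp only [Matrix.det_vandermonde, prod_prod_Ioi_eq_ite]
  rw [← (blockEquiv rfl).prod_comp]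
  simp only [← (blockEquiv (p := p) (k := k) rfl).prod_comp, Function.comp,
    Equiv.symm_apply_apply, Fintype.prod_sum_type, Sum.elim_inl, Sum.elim_inr]
  have h1 : ∀ i j : Fin p, (blockEquiv (p := p) (k := k) rfl (.inl (.inl i)) <
      blockEquiv rfl (.inl (.inl j))) ↔ i < j := by
    intro i j; rw [Fin.lt_def]; simp [blockEquiv]
  have h2 : ∀ (i : Fin p) (j : Fin k), (blockEquiv (p := p) (k := k) rfl (.inl (.inl i)) <
      blockEquiv rfl (.inl (.inr j))) := by
    intro i j; simp [blockEquiv, Fin.lt_def]; omega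
  have h3 : ∀ (i : Fin p) (j : Fin k), (blockEquiv (p := p) (k := k) rfl (.inl (.inl i)) <
      blockEquiv rfl (.inr j)) := by
    intro i j; simp [blockEquiv, Fin.lt_def]; omega
  have h4 : ∀ i j : Fin k, (blockEquiv (p := p) (k := k) rfl (.inl (.inr i)) <
      blockEquiv rfl (.inl (.inr j))) ↔ i < j := by
    intro i j; rw [Fin.lt_def]; simp [blockEquiv]
  have h5 : ∀ i j : Fin k, (blockEquiv (p := p) (k := k) rfl (.inl (.inr i)) <
      blockEquiv rfl (.inr j)) := by
    intro i j; simp [blockEquiv, Fin.lt_def]; omega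
  have h6 : ∀ i j : Fin k, (blockEquiv (p := p) (k := k) rfl (.inr i) <
      blockEquiv rfl (.inr j)) ↔ i < j := by
    intro i j; rw [Fin.lt_def]; simp [blockEquiv]
  simp only [h1, h2, h3, h4, h5, h6, (h2 _ _).not_gt, (h3 _ _).not_gt, (h5 _ _).not_gt, if_true,
    if_false, Finset.prod_mul_distrib, Finset.prod_const_one]
  ring

lemma prod_prod_Ioi_neg_one (k : ℕ) :
    ∏ i : Fin k, ∏ _j ∈ Finset.Ioi i, (-1 : ℝ) = (-1) ^ (k * (k - 1) / 2) := by
  simp only [Finset.prod_const, Fin.card_Ioi]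
  rw [Finset.prod_pow_eq_pow_sum]
  congr 1
  rw [Fin.sum_univ_eq_sum_range (fun i => k - 1 - i) k, Finset.sum_range_reflect (fun i => i) k,
    Finset.sum_range_id]

/-- The matrix with the columns `(1, γ(eᵢ))`, `(1, γ(xⱼ))`, `(0, γ'(xⱼ))`. -/
noncomputable def confluentMatrix {n p k : ℕ} (γ : ℝ → Fin n → ℝ) (e : Fin p → ℝ) (x : Fin k → ℝ) :
    Matrix (Fin (n + 1)) ((Fin p ⊕ Fin k) ⊕ Fin k) ℝ :=
  Matrix.of fun i c => Sum.elim (Sum.elim (fun j => homCoord (γ (e j))) fun j => homCoord (γ (x j)))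
    (fun j => homDir (deriv γ (x j))) c i

/-- The determinant with the columns `(1, γ(eᵢ))`, `(1, γ(xⱼ))`, `(0, γ'(xⱼ))`. -/
noncomputable def confluentDet {n p k : ℕ} (h : p + k + k = n + 1) (γ : ℝ → Fin n → ℝ)
    (e : Fin p → ℝ) (x : Fin k → ℝ) : ℝ :=
  ((confluentMatrix γ e x).submatrix id (blockEquiv h).symm).det

namespace IsPosCurve

variable {n p k : ℕ} {γ : ℝ → Fin n → ℝ} {a b : ℝ}

/-- A left kernel vector is an affine function with simple zeros at e and double zeros at x: p + 2k
= n + 1 zeros in all, one too many. -/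
lemma confluentDet_ne_zero (hγ : IsPosCurve γ a b) (h : p + k + k = n + 1) {e : Fin p → ℝ}
    {x : Fin k → ℝ} (he : ∀ i, e i ∈ Icc a b) (hx : ∀ j, x j ∈ Ioo a b)
    (hinj : Function.Injective (Sum.elim e x)) : confluentDet h γ e x ≠ 0 := by
  intro h0
  obtain ⟨c, hc0, hc⟩ := Matrix.exists_vecMul_eq_zero_iff.2 h0
  have hcol : ∀ q, ∑ i, c i * confluentMatrix γ e x i q = 0 := by
    intro q
    have := congrFun hc (blockEquiv h q)
    simpa [Matrix.vecMul, dotProduct] using this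
  have hxinj : Function.Injective x := fun i j hij => by
    have := @hinj (.inr i) (.inr j) (by simpa using hij)
    simpa using this
  refine hc0 (hγ.eq_zero_of_zeros c (Finset.univ.image (Sum.elim e x)) (Finset.univ.image x)
    ?_ ?_ ?_ ?_ ?_ ?_)
  · intro z hz
    obtain ⟨q, -, rfl⟩ := Finset.mem_image.1 hz
    rcases q with i | j
    · exact he i
    · exact Ioo_subset_Icc_self (hx j)
  · intro z hz
    obtain ⟨j, -, rfl⟩ := Finset.mem_image.1 hz
    exact hx j
  · intro z hz
    obtain ⟨j, -, rfl⟩ := Finset.mem_image.1 hz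
    exact Finset.mem_image.2 ⟨.inr j, by simp, rfl⟩
  · rw [Finset.card_image_of_injective _ hinj, Finset.card_image_of_injective _ hxinj]
    simp [h]
  · intro z hz
    obtain ⟨q, -, rfl⟩ := Finset.mem_image.1 hz
    rcases q with i | j
    · exact hcol (.inl (.inl i))
    · exact hcol (.inl (.inr j))
  · intro z hz
    obtain ⟨j, -, rfl⟩ := Finset.mem_image.1 hz
    exact hcol (.inr j)

/-- The difference quotient of the doubled columns is a column operation. -/
lemma det_slope_columns (h : p + k + k = n + 1) (e : Fin p → ℝ) (x : Fin k → ℝ) (ε : ℝ) :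
    ((Matrix.of fun i c => Sum.elim (Sum.elim (fun j => homCoord (γ (e j)))
        fun j => homCoord (γ (x j)))
        (fun j => ε⁻¹ • (homCoord (γ (x j + ε)) - homCoord (γ (x j)))) c i :
        Matrix (Fin (n + 1)) ((Fin p ⊕ Fin k) ⊕ Fin k) ℝ).submatrix id (blockEquiv h).symm).det =
      (ε⁻¹) ^ k * (Matrix.of fun i j => homCoord (γ ((Sum.elim (Sum.elim e x) (fun j => x j + ε) ∘
        (blockEquiv h).symm) j)) i).det := by
  let M : Matrix (Fin (n + 1)) ((Fin p ⊕ Fin k) ⊕ Fin k) ℝ := Matrix.of fun i c =>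
    homCoord (γ (Sum.elim (Sum.elim e x) (fun j => x j + ε) c)) i
  let T : Matrix ((Fin p ⊕ Fin k) ⊕ Fin k) ((Fin p ⊕ Fin k) ⊕ Fin k) ℝ :=
    Matrix.fromBlocks 1 (Matrix.fromRows 0 (-(ε⁻¹ • (1 : Matrix (Fin k) (Fin k) ℝ)))) 0
      (ε⁻¹ • (1 : Matrix (Fin k) (Fin k) ℝ))
  have hT : T.det = (ε⁻¹) ^ k := by
    simp [T, Matrix.det_fromBlocks_zero₂₁]
  have hM : (Matrix.of fun i c => Sum.elim (Sum.elim (fun j => homCoord (γ (e j)))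
        fun j => homCoord (γ (x j)))
        (fun j => ε⁻¹ • (homCoord (γ (x j + ε)) - homCoord (γ (x j)))) c i :
        Matrix (Fin (n + 1)) ((Fin p ⊕ Fin k) ⊕ Fin k) ℝ) = M * T := by
    ext i c
    rcases c with (c | c) | c
    · simp [M, T, Matrix.mul_apply, Matrix.one_apply]
    · simp [M, T, Matrix.mul_apply, Matrix.one_apply]
    · simp [M, T, Matrix.mul_apply, Matrix.one_apply]
      ring
  rw [hM, ← Matrix.submatrix_mul_equiv M T id (blockEquiv h).symm (blockEquiv h).symm,
    Matrix.det_mul, Matrix.det_submatrix_equiv_self, hT, mul_comm]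
  rfl

/-- Each double point is the limit of the pair xⱼ, xⱼ + ε as ε → 0⁺; the sign is read off the
Vandermonde determinant of the split points. -/
theorem confluentDet_mul_pos (hγ : IsPosCurve γ a b) (h : p + k + k = n + 1) {e : Fin p → ℝ}
    {x : Fin k → ℝ} (he : ∀ i, e i ∈ Icc a b) (hx : ∀ j, x j ∈ Ioo a b)
    (hinj : Function.Injective (Sum.elim e x)) :
    0 < (-1) ^ (k * (k - 1) / 2) * (Matrix.vandermonde e).det * confluentDet h γ e x := by
  have hxinj : Function.Injective x := fun i j hij => by
    have := @hinj (.inr i) (.inr j) (by simpa using hij)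
    simpa using this
  have hex : ∀ i j, x j - e i ≠ 0 := fun i j hij => by
    have := @hinj (.inr j) (.inl i) (by simpa [sub_eq_zero] using hij)
    simp at this
  have heinj : Function.Injective e := fun i j hij => by
    have := @hinj (.inl i) (.inl j) (by simpa using hij)
    simpa using this
  let D : ℝ → ℝ := fun ε => ((Matrix.of fun i c => Sum.elim (Sum.elim (fun j => homCoord (γ (e j)))
        fun j => homCoord (γ (x j)))
        (fun j => ε⁻¹ • (homCoord (γ (x j + ε)) - homCoord (γ (x j)))) c i :
        Matrix (Fin (n + 1)) ((Fin p ⊕ Fin k) ⊕ Fin k) ℝ).submatrix id (blockEquiv h).symm).det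
  -- The Vandermonde determinant of the split points divided by ε^k: the diagonal factors xⱼ + ε -
  -- xⱼ are removed, and the off-diagonal ones are grouped in pairs (i, j), (j, i).
  let R : ℝ → ℝ := fun ε => (Matrix.vandermonde e).det * (∏ i, ∏ j, (x j - e i)) *
      (Matrix.vandermonde x).det * (∏ i, ∏ j, (x j + ε - e i)) *
      (∏ i, ∏ j ∈ Finset.Ioi i, (x j + ε - x i) * (x i + ε - x j)) * (Matrix.vandermonde x).det
  have hV : ∀ ε, (Matrix.vandermonde (Sum.elim (Sum.elim e x) (fun j => x j + ε) ∘
      (blockEquiv h).symm)).det = ε ^ k * R ε := by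
    intro ε
    rw [det_vandermonde_blocks, Matrix.det_vandermonde_add]
    have : ∏ i, ∏ j, (x j + ε - x i) = ε ^ k *
        ∏ i, ∏ j ∈ Finset.Ioi i, (x j + ε - x i) * (x i + ε - x j) := by
      rw [Finset.prod_prod_Ioi_mul_eq_prod_prod_off_diag (fun j i => x j + ε - x i)]
      have : ε ^ k = ∏ i : Fin k, (x i + ε - x i) := by simp
      rw [this, ← Finset.prod_mul_distrib]
      refine Finset.prod_congr rfl fun i _ => ?_
      rw [← Finset.prod_mul_prod_compl {i}]
      simp
    rw [this]
    simp only [R]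
    ring
  have hDpos : ∀ᶠ ε in nhdsWithin (0 : ℝ) (Ioi 0), 0 < D ε * R ε := by
    have t0 : ∀ j, Filter.Tendsto (fun ε => x j + ε) (nhdsWithin (0 : ℝ) (Ioi 0)) (nhds (x j)) := by
      intro j
      have : Filter.Tendsto (fun ε => x j + ε) (nhds (0 : ℝ)) (nhds (x j + 0)) :=
        (continuous_const.add continuous_id).tendsto 0
      rw [add_zero] at this
      exact this.mono_left nhdsWithin_le_nhds
    have e1 : ∀ᶠ ε in nhdsWithin (0 : ℝ) (Ioi 0), ∀ j, x j + ε ∈ Ioo a b :=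
      Filter.eventually_all.2 fun j => (t0 j).eventually (isOpen_Ioo.mem_nhds (hx j))
    have e2 : ∀ᶠ ε in nhdsWithin (0 : ℝ) (Ioi 0), ∀ j q, q ≠ Sum.inr j →
        x j + ε ≠ Sum.elim e x q := by
      refine Filter.eventually_all.2 fun j => Filter.eventually_all.2 fun q => ?_
      by_cases hq : q = .inr j
      · simp [hq]
      · have : x j ≠ Sum.elim e x q := fun hh => hq (hinj (by simpa using hh.symm))
        filter_upwards [(t0 j).eventually_ne this] with ε hε _ using hε
    filter_upwards [e1, e2, self_mem_nhdsWithin] with ε h1 h2 h3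
    have h3 : 0 < ε := h3
    have key := hγ.det_homCoord_mul_vandermonde_pos
      (Sum.elim (Sum.elim e x) (fun j => x j + ε) ∘ (blockEquiv h).symm) ?_ ?_
    · rw [hV] at key
      simp only [D]
      rw [det_slope_columns]
      have hpos : 0 < (ε⁻¹) ^ k * (ε⁻¹) ^ k := by positivity
      have := mul_pos hpos key
      have hε : (ε⁻¹) ^ k * ε ^ k = 1 := by rw [← mul_pow, inv_mul_cancel₀ h3.ne', one_pow]
      calc (0 : ℝ) < _ := this
        _ = ((ε⁻¹) ^ k * ε ^ k) * ((ε⁻¹) ^ k * (Matrix.of fun i j => homCoord (γ ((Sum.elim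
          (Sum.elim e x) (fun j => x j + ε) ∘ (blockEquiv h).symm) j)) i).det * R ε) := by ring
        _ = _ := by rw [hε, one_mul]
    · refine Function.Injective.comp ?_ (blockEquiv h).symm.injective
      have hne : ∀ q j, Sum.elim e x q ≠ x j + ε := by
        intro q j
        by_cases hq : q = .inr j
        · subst hq; simp [h3.ne']
        · exact (h2 j q hq).symm
      exact hinj.sumElim (fun i j hij => hxinj (by simpa using hij)) hne
    · intro j
      simp only [Function.comp]
      rcases (blockEquiv h).symm j with (i | i) | i
      · exact he i
      · exact Ioo_subset_Icc_self (hx i)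
      · exact Ioo_subset_Icc_self (h1 i)
  have hDlim : Filter.Tendsto D (nhdsWithin (0 : ℝ) (Ioi 0)) (nhds (confluentDet h γ e x)) := by
    have hcont : Continuous fun M : Matrix (Fin (n + 1)) ((Fin p ⊕ Fin k) ⊕ Fin k) ℝ =>
        (M.submatrix id (blockEquiv h).symm).det :=
      (continuous_id.matrix_submatrix _ _).matrix_det
    refine (hcont.tendsto _).comp ?_
    refine tendsto_pi_nhds.2 fun i => tendsto_pi_nhds.2 fun c => ?_
    rcases c with c | j
    · exact tendsto_const_nhds
    · simp only [confluentMatrix, Matrix.of_apply, Sum.elim_inr]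
      have hd := hasDerivAt_pi.1 (hγ.differentiableAt _ (hx j)).hasDerivAt
      refine Fin.cases ?_ (fun i => ?_) i
      · simp
      · have := (hasDerivAt_iff_tendsto_slope_zero.1 (hd i)).mono_left
          (nhdsWithin_mono (0 : ℝ) (show Ioi (0 : ℝ) ⊆ {0}ᶜ from fun t ht => (mem_Ioi.1 ht).ne'))
        simpa using this
  have hRlim : Filter.Tendsto R (nhdsWithin (0 : ℝ) (Ioi 0)) (nhds (R 0)) := by
    have : Continuous R := by fun_prop
    exact (this.tendsto 0).mono_left nhdsWithin_le_nhds
  have hge : 0 ≤ confluentDet h γ e x * R 0 :=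
    ge_of_tendsto (hDlim.mul hRlim) (hDpos.mono fun _ => le_of_lt)
  -- At ε = 0 each pair i < j contributes -(xⱼ - xᵢ)², which is the source of the sign
  -- (-1)^(k(k-1)/2).
  have hR0 : R 0 = ((-1) ^ (k * (k - 1) / 2) * (Matrix.vandermonde e).det) *
      ((∏ i, ∏ j, (x j - e i)) * (Matrix.vandermonde x).det *
        ∏ i, ∏ j ∈ Finset.Ioi i, (x j - x i)) ^ 2 := by
    have : ∏ i, ∏ j ∈ Finset.Ioi i, (x j + 0 - x i) * (x i + 0 - x j) =
        (-1) ^ (k * (k - 1) / 2) * (∏ i, ∏ j ∈ Finset.Ioi i, (x j - x i)) ^ 2 := by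
      rw [← prod_prod_Ioi_neg_one, sq, ← Finset.prod_mul_distrib, ← Finset.prod_mul_distrib]
      refine Finset.prod_congr rfl fun i _ => ?_
      rw [← Finset.prod_mul_distrib, ← Finset.prod_mul_distrib]
      exact Finset.prod_congr rfl fun j _ => by ring
    simp only [R]
    rw [this]
    simp only [add_zero]
    ring
  have hQ : 0 < ((∏ i, ∏ j, (x j - e i)) * (Matrix.vandermonde x).det *
        ∏ i, ∏ j ∈ Finset.Ioi i, (x j - x i)) ^ 2 := by
    rw [← Matrix.det_vandermonde]
    have h1 := Matrix.det_vandermonde_ne_zero_iff.2 hxinj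
    have h2 : ∏ i, ∏ j, (x j - e i) ≠ 0 :=
      Finset.prod_ne_zero_iff.2 fun i _ => Finset.prod_ne_zero_iff.2 fun j _ => hex i j
    positivity
  rw [hR0, ← mul_assoc] at hge
  have hge' := nonneg_of_mul_nonneg_left hge hQ
  rw [mul_comm] at hge'
  -- The limit gives only a weak inequality; nonvanishing makes it strict.
  refine lt_of_le_of_ne hge' (Ne.symm ?_)
  refine mul_ne_zero (mul_ne_zero (by simp) (Matrix.det_vandermonde_ne_zero_iff.2 heinj))
    (hγ.confluentDet_ne_zero h he hx hinj)

end IsPosCurve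

/-! ### Totally positive curves and supporting hyperplanes. -/

/-- The projection of a curve to the first `w` coordinates. -/
def truncCurve {n w : ℕ} (hw : w ≤ n) (γ : ℝ → Fin n → ℝ) : ℝ → Fin w → ℝ :=
  fun t i => γ t (Fin.castLE hw i)

lemma homCoord_truncCurve {n w : ℕ} (hw : w ≤ n) (γ : ℝ → Fin n → ℝ) (t : ℝ) (i : Fin (w + 1)) :
    homCoord (truncCurve hw γ t) i = homCoord (γ t) (Fin.castLE (Nat.succ_le_succ hw) i) := by
  refine Fin.cases ?_ (fun i => ?_) i
  · rfl
  · rfl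

/-- A curve all of whose projections to the first coordinates are positive curves. -/
def IsTotallyPosCurve {n : ℕ} (γ : ℝ → Fin n → ℝ) (a b : ℝ) : Prop :=
  ∀ (w : ℕ) (hw : w ≤ n), IsPosCurve (truncCurve hw γ) a b

theorem HasTotallyPositiveTorsion.isTotallyPosCurve {n : ℕ} (hn : 1 ≤ n) {γ : ℝ → Fin n → ℝ}
    {a b : ℝ} (hcont : ContinuousOn γ (Icc a b)) (hdiff : ContDiffOn ℝ n γ (Ioo a b))
    (h : HasTotallyPositiveTorsion γ a b) : IsTotallyPosCurve γ a b := by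
  intro w hw
  have hd : ∀ t ∈ Ioo a b, DifferentiableAt ℝ γ t := fun t ht =>
    (hdiff.contDiffAt (isOpen_Ioo.mem_nhds ht)).differentiableAt (by exact_mod_cast (by omega))
  have hd' : ∀ t ∈ Ioo a b, HasDerivAt (truncCurve hw γ)
      (fun i => deriv γ t (Fin.castLE hw i)) t := fun t ht =>
    hasDerivAt_pi.2 fun i => hasDerivAt_pi.1 (hd t ht).hasDerivAt _
  refine ⟨continuousOn_pi.2 fun i => continuousOn_pi.1 hcont _,
    fun t ht => (hd' t ht).differentiableAt, fun s hs hsI => ?_⟩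
  have := h.det_deriv_pos hdiff hw s hs hsI
  convert this using 2
  ext i j
  simp only [Matrix.of_apply]
  rw [(hd' _ (hsI j)).deriv]

namespace IsTotallyPosCurve

variable {n : ℕ} {γ : ℝ → Fin n → ℝ} {a b : ℝ}

lemma isPosCurve (hγ : IsTotallyPosCurve γ a b) : IsPosCurve γ a b := hγ n le_rfl

/-- Any `n + 1` points of the curve are affinely independent. -/
lemma eq_zero_of_sum_homCoord (hγ : IsTotallyPosCurve γ a b) (N : Finset ℝ)
    (hN : ∀ t ∈ N, t ∈ Icc a b) (hcard : N.card ≤ n + 1) (α : ℝ → ℝ)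
    (hα : ∑ t ∈ N, α t • homCoord (γ t) = 0) : ∀ t ∈ N, α t = 0 := by
  intro t ht
  obtain ⟨w, hw⟩ : ∃ w, N.card = w + 1 :=
    ⟨N.card - 1, by have := Finset.card_pos.2 ⟨t, ht⟩; omega⟩
  have hwn : w ≤ n := by omega
  let y := N.orderEmbOfFin hw
  have hyN : ∀ i, y i ∈ N := fun i => N.orderEmbOfFin_mem hw i
  have hdet := (hγ w hwn).det_homCoord_pos y y.strictMono fun j => hN _ (hyN j)
  have hsum : ∀ i, ∑ j, α (y j) * homCoord (γ (y j)) i = 0 := by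
    intro i
    have h1 := congrFun hα i
    simp only [Finset.sum_apply, Pi.smul_apply, smul_eq_mul, Pi.zero_apply] at h1
    rw [← h1]
    have himg : N = Finset.univ.image y := by
      have := Finset.range_orderEmbOfFin N hw
      apply Finset.coe_injective
      rw [← this]; simp [y]
    conv_rhs => rw [himg]
    rw [Finset.sum_image fun i _ j _ hij => y.injective hij]
  have hz : (fun j => α (y j)) = 0 := by
    refine Matrix.eq_zero_of_mulVec_eq_zero hdet.ne' ?_
    ext i
    simp only [Matrix.mulVec, dotProduct, Matrix.of_apply, Pi.zero_apply, homCoord_truncCurve]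
    rw [← hsum (Fin.castLE (Nat.succ_le_succ hwn) i)]
    exact Finset.sum_congr rfl fun j _ => mul_comm _ _
  have : t ∈ Set.range y := by rw [Finset.range_orderEmbOfFin]; exact ht
  obtain ⟨j, rfl⟩ := this
  exact congrFun hz j

/-- A finite set of parameters, of total weight at most `n` when interior parameters have weight
two, lies on a supporting hyperplane of the curve. -/
lemma exists_supporting (hγ : IsTotallyPosCurve γ a b) (hab : a < b) (N : Finset ℝ)
    (hN : ∀ t ∈ N, t ∈ Icc a b) (hcard : N.card + (N.filter (· ∈ Ioo a b)).card ≤ n) :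
    ∃ L : (Fin (n + 1) → ℝ) →ₗ[ℝ] ℝ, (∀ t ∈ Icc a b, 0 ≤ L (homCoord (γ t))) ∧
      (∀ t ∈ N, L (homCoord (γ t)) = 0) ∧ ∃ t ∈ Icc a b, 0 < L (homCoord (γ t)) := by
  classical
  set X := N.filter (· ∈ Ioo a b) with hX
  set E := N.filter (· ∉ Ioo a b) with hE
  have hEX : X.card + E.card = N.card := Finset.card_filter_add_card_filter_not _
  set p := E.card with hp
  set k := X.card with hk
  -- The weight w may be less than n. Projecting to the first w coordinates makes the determinant
  -- with one additional free point square.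
  obtain ⟨w, hw⟩ : ∃ w, w = N.card + k := ⟨_, rfl⟩
  have hwn : w ≤ n := by omega
  have h : p + 1 + k + k = w + 1 := by omega
  let e := E.orderEmbOfFin hp.symm
  let x := X.orderEmbOfFin hk.symm
  have heE : ∀ i, e i ∈ E := fun i => E.orderEmbOfFin_mem _ i
  have hxX : ∀ i, x i ∈ X := fun i => X.orderEmbOfFin_mem _ i
  have heN : ∀ i, e i ∈ N := fun i => (Finset.mem_filter.1 (heE i)).1
  have hxN : ∀ i, x i ∈ N := fun i => (Finset.mem_filter.1 (hxX i)).1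
  have hxI : ∀ i, x i ∈ Ioo a b := fun i => (Finset.mem_filter.1 (hxX i)).2
  have heI : ∀ i, e i = a ∨ e i = b := by
    intro i
    have h1 := hN _ (heN i)
    have h2 := (Finset.mem_filter.1 (heE i)).2
    by_contra hcon
    push Not at hcon
    exact h2 ⟨lt_of_le_of_ne h1.1 hcon.1.symm, lt_of_le_of_ne h1.2 hcon.2⟩
  -- The point t is the free column. On N a column repeats, so f vanishes there. Interior parameters
  -- are doubled and the others are endpoints, so f has constant sign on the rest of [a, b].
  let f : ℝ → ℝ := fun t => confluentDet h (truncCurve hwn γ) (Fin.cons t e : Fin (p + 1) → ℝ) x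
  obtain ⟨t₀, ht₀, ht₀N⟩ := (Ioo_infinite hab).exists_notMem_finset N
  have hpos : ∀ t ∈ Icc a b, t ∉ N → 0 < (-1) ^ (k * (k - 1) / 2) *
      ((∏ i, (e i - t)) * (Matrix.vandermonde e).det) * f t := by
    intro t ht htN
    have hinj : Function.Injective (Sum.elim (Fin.cons t e : Fin (p + 1) → ℝ) x) := by
      refine Function.Injective.sumElim ?_ x.injective ?_
      · refine Fin.cons_injective_iff.2 ⟨?_, e.injective⟩
        rintro ⟨i, rfl⟩
        exact htN (heN i)
      · intro i j
        refine Fin.cases ?_ (fun i => ?_) i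
        · rintro rfl
          exact htN (hxN j)
        · simp only [Fin.cons_succ]
          intro hij
          have := (Finset.mem_filter.1 (heE i)).2
          rw [hij] at this
          exact this (hxI j)
    have := (hγ w hwn).confluentDet_mul_pos h (e := Fin.cons t e) (x := x) ?_ hxI hinj
    · rw [Matrix.det_vandermonde, Fin.prod_univ_succ] at this
      simpa [Fin.prod_Ioi_zero, Fin.prod_Ioi_succ, ← Matrix.det_vandermonde] using this
    · intro i
      refine Fin.cases ht (fun i => hN _ (heN i)) i
  have hff : ∀ t ∈ Icc a b, t ∉ N → 0 < f t₀ * f t := by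
    intro t ht htN
    have h1 := mul_pos (hpos t ht htN) (hpos t₀ (Ioo_subset_Icc_self ht₀) ht₀N)
    have h2 : 0 ≤ ((-1 : ℝ) ^ (k * (k - 1) / 2)) ^ 2 * (Matrix.vandermonde e).det ^ 2 *
        ∏ i, ((e i - t) * (e i - t₀)) := by
      refine mul_nonneg (by positivity) (Finset.prod_nonneg fun i _ => ?_)
      rcases heI i with hi | hi <;> rw [hi]
      · exact mul_nonneg_of_nonpos_of_nonpos (by linarith [ht.1]) (by linarith [ht₀.1])
      · exact mul_nonneg (by linarith [ht.2]) (by linarith [ht₀.2])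
    refine pos_of_mul_pos_right (a := ((-1 : ℝ) ^ (k * (k - 1) / 2)) ^ 2 *
      (Matrix.vandermonde e).det ^ 2 * ∏ i, ((e i - t) * (e i - t₀))) ?_ h2
    rw [Finset.prod_mul_distrib]
    calc (0 : ℝ) < _ := h1
      _ = _ := by ring
  let q : Fin (w + 1) := blockEquiv h (.inl (.inl 0))
  let A : Matrix (Fin (w + 1)) (Fin (w + 1)) ℝ := (confluentMatrix (truncCurve hwn γ)
    (Fin.cons t₀ e : Fin (p + 1) → ℝ) x).submatrix id (blockEquiv h).symm
  let L₁ : (Fin (w + 1) → ℝ) →ₗ[ℝ] ℝ := (LinearMap.proj q).comp (Matrix.cramer A)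
  -- The factor f t₀ makes the functional positive without computing its sign.
  let L : (Fin (n + 1) → ℝ) →ₗ[ℝ] ℝ :=
    f t₀ • L₁.comp (LinearMap.funLeft ℝ ℝ (Fin.castLE (Nat.succ_le_succ hwn)))
  have hL₁ : ∀ t, L₁ (homCoord (truncCurve hwn γ t)) = f t := by
    intro t
    change Matrix.cramer A _ q = _
    rw [Matrix.cramer_apply]
    simp only [f, confluentDet]
    congr 1
    ext i j
    obtain ⟨j, rfl⟩ := (blockEquiv h).surjective j
    by_cases hj : j = .inl (.inl 0)
    · subst hj
      simp [q, confluentMatrix]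
    · have : blockEquiv h j ≠ q := fun hh => hj ((blockEquiv h).injective hh)
      rw [Matrix.updateCol_ne this]
      simp only [A, Matrix.submatrix_apply, Equiv.symm_apply_apply, confluentMatrix,
        Matrix.of_apply]
      rcases j with (j | j) | j
      · revert hj
        refine Fin.cases ?_ (fun j => ?_) j
        · simp
        · simp
      · rfl
      · rfl
  have hL : ∀ t, L (homCoord (γ t)) = f t₀ * f t := by
    intro t
    rw [← hL₁ t]
    change f t₀ * L₁ _ = f t₀ * L₁ _
    congr 2
    ext i
    rw [homCoord_truncCurve]
    rfl
  have hzero : ∀ t ∈ N, f t = 0 := by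
    intro t ht
    obtain ⟨c, hc, hct⟩ : ∃ c : (Fin (p + 1) ⊕ Fin k) ⊕ Fin k, c ≠ .inl (.inl 0) ∧
        ∀ i, confluentMatrix (truncCurve hwn γ) (Fin.cons t e : Fin (p + 1) → ℝ) x i c =
          homCoord (truncCurve hwn γ t) i := by
      by_cases htI : t ∈ Ioo a b
      · have : t ∈ Set.range x := by
          rw [Finset.range_orderEmbOfFin]; exact Finset.mem_filter.2 ⟨ht, htI⟩
        obtain ⟨j, rfl⟩ := this
        exact ⟨.inl (.inr j), by simp, fun i => rfl⟩
      · have : t ∈ Set.range e := by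
          rw [Finset.range_orderEmbOfFin]; exact Finset.mem_filter.2 ⟨ht, htI⟩
        obtain ⟨j, rfl⟩ := this
        exact ⟨.inl (.inl j.succ), by simp, fun i => rfl⟩
    refine Matrix.det_zero_of_column_eq (i := q) (j := blockEquiv h c)
      (fun hh => hc ((blockEquiv h).injective hh).symm) fun i => ?_
    simp only [q, Matrix.submatrix_apply, Equiv.symm_apply_apply, id]
    rw [hct]
    rfl
  refine ⟨L, fun t ht => ?_, fun t ht => ?_, t₀, Ioo_subset_Icc_self ht₀, ?_⟩
  · rw [hL]
    by_cases htN : t ∈ N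
    · simp [hzero t htN]
    · exact (hff t ht htN).le
  · simp [hL, hzero t ht]
  · rw [hL]
    exact hff t₀ (Ioo_subset_Icc_self ht₀) ht₀N

end IsTotallyPosCurve

/-! ### The cone over the hull and its representations by points of the curve. -/

/-- The cone over `K ⊆ ℝⁿ`, placed at height one in `ℝⁿ⁺¹`. -/
def coneOver {n : ℕ} (K : Set (Fin n → ℝ)) : Set (Fin (n + 1) → ℝ) :=
  {y | 0 < y 0 ∧ ((y 0)⁻¹ • fun i : Fin n => y i.succ) ∈ K}

lemma eq_smul_homCoord {n : ℕ} {y : Fin (n + 1) → ℝ} (hy : 0 < y 0) :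
    y = y 0 • homCoord ((y 0)⁻¹ • fun i : Fin n => y i.succ) := by
  ext i
  refine Fin.cases ?_ (fun i => ?_) i
  · simp
  · simp [hy.ne']

lemma homCoord_add_smul {n : ℕ} (v w : Fin n → ℝ) {α β : ℝ} (h : α + β = 1) :
    homCoord (α • v + β • w) = α • homCoord v + β • homCoord w := by
  ext i
  refine Fin.cases ?_ (fun i => ?_) i
  · simp [h]
  · simp

/-- Normalised to height one, α y + β z is the combination of the normalised points with weights
proportional to α y₀ and β z₀. -/
lemma convex_coneOver {n : ℕ} {K : Set (Fin n → ℝ)} (hK : Convex ℝ K) :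
    Convex ℝ (coneOver K) := by
  intro y hy z hz α β hα hβ hαβ
  have hs : 0 < α * y 0 + β * z 0 := by
    rcases hα.eq_or_lt with rfl | hα'
    · have : β = 1 := by linarith
      subst this
      simpa using hz.1
    · have := mul_pos hα' hy.1
      have := mul_nonneg hβ hz.1.le
      linarith
  have hmem := hK hy.2 hz.2 (a := α * y 0 / (α * y 0 + β * z 0))
    (b := β * z 0 / (α * y 0 + β * z 0)) (div_nonneg (mul_nonneg hα hy.1.le) hs.le)
    (div_nonneg (mul_nonneg hβ hz.1.le) hs.le) (by rw [← add_div, div_self hs.ne'])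
  refine ⟨by simpa using hs, ?_⟩
  convert hmem using 1
  ext i
  have h1 := hy.1.ne'
  have h2 := hz.1.ne'
  simp only [Pi.smul_apply, Pi.add_apply, smul_eq_mul]
  field_simp

/-- The point of the cone over the curve with weights `c` at the fixed parameters `e` and at the
moving parameters `x`. -/
noncomputable def conePoint {n p k : ℕ} (γ : ℝ → Fin n → ℝ) (e : Fin p → ℝ)
    (c : Fin p ⊕ Fin k → ℝ) (x : Fin k → ℝ) : Fin (n + 1) → ℝ :=
  ∑ q, c q • homCoord (γ (Sum.elim e x q))

lemma conePoint_zero {n p k : ℕ} (γ : ℝ → Fin n → ℝ) (e : Fin p → ℝ)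
    (c : Fin p ⊕ Fin k → ℝ) (x : Fin k → ℝ) : conePoint γ e c x 0 = ∑ q, c q := by
  simp [conePoint, Finset.sum_apply]

lemma conePoint_mem_coneOver {n p k : ℕ} {γ : ℝ → Fin n → ℝ} {a b : ℝ} {e : Fin p → ℝ}
    (he : ∀ i, e i ∈ Icc a b) {c : Fin p ⊕ Fin k → ℝ} {x : Fin k → ℝ} (hc : ∀ q, 0 ≤ c q)
    (hpos : 0 < ∑ q, c q) (hx : ∀ j, x j ∈ Icc a b) :
    conePoint γ e c x ∈ coneOver (convexHull ℝ (γ '' Icc a b)) := by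
  have hmem : ∀ q, γ (Sum.elim e x q) ∈ convexHull ℝ (γ '' Icc a b) := by
    intro q
    refine subset_convexHull ℝ _ (mem_image_of_mem _ ?_)
    rcases q with q | q
    · exact he q
    · exact hx q
  refine ⟨by rwa [conePoint_zero], ?_⟩
  rw [conePoint_zero]
  have h := (convex_convexHull ℝ (γ '' Icc a b)).sum_mem (t := Finset.univ)
    (w := fun q => (∑ q, c q)⁻¹ * c q) (z := fun q => γ (Sum.elim e x q))
    (fun q _ => mul_nonneg (inv_nonneg.2 hpos.le) (hc q))
    (by rw [← Finset.mul_sum, inv_mul_cancel₀ hpos.ne']) (fun q _ => hmem q)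
  convert h using 1
  ext i
  simp [conePoint, Finset.sum_apply, Finset.mul_sum, -Fintype.sum_sum_type, mul_assoc]

lemma nonneg_of_mem_coneOver {n : ℕ} {γ : ℝ → Fin n → ℝ} {a b : ℝ}
    {L : (Fin (n + 1) → ℝ) →ₗ[ℝ] ℝ} (hL : ∀ t ∈ Icc a b, 0 ≤ L (homCoord (γ t)))
    {y : Fin (n + 1) → ℝ} (hy : y ∈ coneOver (convexHull ℝ (γ '' Icc a b))) : 0 ≤ L y := by
  have hconv : Convex ℝ {v : Fin n → ℝ | 0 ≤ L (homCoord v)} := by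
    intro v hv w hw α β hα hβ hαβ
    simp only [mem_ofPred_eq] at hv hw ⊢
    rw [homCoord_add_smul v w hαβ, map_add, map_smul, map_smul]
    exact add_nonneg (mul_nonneg hα hv) (mul_nonneg hβ hw)
  have hsub : convexHull ℝ (γ '' Icc a b) ⊆ {v : Fin n → ℝ | 0 ≤ L (homCoord v)} :=
    convexHull_min (by rintro _ ⟨t, ht, rfl⟩; exact hL t ht) hconv
  rw [eq_smul_homCoord hy.1, map_smul]
  exact mul_nonneg hy.1.le (hsub hy.2)

namespace IsTotallyPosCurve

variable {n p k : ℕ} {γ : ℝ → Fin n → ℝ} {a b : ℝ}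

/-- A vanishing weight, a repeated parameter or a moving parameter at an endpoint lowers the weight
of the support to at most n. The point then lies on a supporting hyperplane, hence not in the
interior. -/
lemma nondegenerate_of_conePoint_mem_interior (hγ : IsTotallyPosCurve γ a b) (hab : a < b)
    (h : p + k + k = n + 1) {e : Fin p → ℝ} (he : ∀ i, e i = a ∨ e i = b)
    {c : Fin p ⊕ Fin k → ℝ} {x : Fin k → ℝ} (hc : ∀ q, 0 ≤ c q) (hx : ∀ j, x j ∈ Icc a b)
    (hmem : conePoint γ e c x ∈ interior (coneOver (convexHull ℝ (γ '' Icc a b)))) :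
    (∀ q, 0 < c q) ∧ Function.Injective x ∧ ∀ j, x j ∈ Ioo a b := by
  classical
  have heI : ∀ i, e i ∈ Icc a b := fun i => by
    rcases he i with hi | hi <;> rw [hi]
    exacts [left_mem_Icc.2 hab.le, right_mem_Icc.2 hab.le]
  have heI' : ∀ i, e i ∉ Ioo a b := fun i => by
    rcases he i with hi | hi <;> rw [hi] <;> simp
  let F : Finset (Fin p) := Finset.univ.filter fun i => c (.inl i) ≠ 0
  let G : Finset (Fin k) := Finset.univ.filter fun j => c (.inr j) ≠ 0
  let I := G.image x
  let J := I.filter (· ∈ Ioo a b)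
  let N := F.image e ∪ I
  have hNI : ∀ t ∈ N, t ∈ Icc a b := by
    intro t ht
    rcases Finset.mem_union.1 ht with ht | ht
    · obtain ⟨i, -, rfl⟩ := Finset.mem_image.1 ht; exact heI i
    · obtain ⟨j, -, rfl⟩ := Finset.mem_image.1 ht; exact hx j
  have hNJ : N.filter (· ∈ Ioo a b) ⊆ J := by
    intro t ht
    obtain ⟨htN, htI⟩ := Finset.mem_filter.1 ht
    rcases Finset.mem_union.1 htN with ht | ht
    · obtain ⟨i, -, rfl⟩ := Finset.mem_image.1 ht; exact absurd htI (heI' i)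
    · exact Finset.mem_filter.2 ⟨ht, htI⟩
  have hcF : F.card ≤ p := (Finset.card_le_univ _).trans_eq (Fintype.card_fin _)
  have hcG : G.card ≤ k := (Finset.card_le_univ _).trans_eq (Fintype.card_fin _)
  have hcI : I.card ≤ G.card := Finset.card_image_le
  have hcJ : J.card ≤ I.card := Finset.card_filter_le _ _
  have hcN : N.card ≤ F.card + I.card :=
    (Finset.card_union_le _ _).trans (Nat.add_le_add_right Finset.card_image_le _)
  have hcNJ := Finset.card_le_card hNJ
  have hbig : n + 1 ≤ N.card + (N.filter (· ∈ Ioo a b)).card := by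
    by_contra hlt
    obtain ⟨L, hL0, hLN, t₀, ht₀, hLt₀⟩ := hγ.exists_supporting hab N hNI (by omega)
    have hLy : L (conePoint γ e c x) = 0 := by
      rw [conePoint, map_sum]
      refine Finset.sum_eq_zero fun q _ => ?_
      rw [map_smul]
      by_cases hq : c q = 0
      · simp [hq]
      · rw [hLN, smul_zero]
        rcases q with i | j
        · exact Finset.mem_union_left _ (Finset.mem_image_of_mem e (by simp [F, hq]))
        · exact Finset.mem_union_right _ (Finset.mem_image_of_mem x (by simp [G, hq]))
    -- Moving slightly away from a curve point with L > 0 would stay in the cone yet make L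
    -- negative.
    have htend : Filter.Tendsto (fun δ : ℝ => conePoint γ e c x - δ • homCoord (γ t₀))
        (nhdsWithin 0 (Ioi 0)) (nhds (conePoint γ e c x)) := by
      have : Continuous fun δ : ℝ => conePoint γ e c x - δ • homCoord (γ t₀) := by fun_prop
      have := (this.tendsto 0).mono_left (nhdsWithin_le_nhds (s := Ioi 0))
      simpa using this
    obtain ⟨δ, hδ, hδ0⟩ := ((htend.eventually (isOpen_interior.mem_nhds hmem)).and
      self_mem_nhdsWithin).exists
    have := nonneg_of_mem_coneOver hL0 (interior_subset hδ)
    rw [map_sub, hLy, map_smul, smul_eq_mul] at this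
    have := mul_pos (mem_Ioi.1 hδ0) hLt₀
    linarith
  have hF : F = Finset.univ := Finset.eq_univ_of_card _ (by rw [Fintype.card_fin]; omega)
  have hG : G = Finset.univ := Finset.eq_univ_of_card _ (by rw [Fintype.card_fin]; omega)
  have hJI : J = I := Finset.eq_of_subset_of_card_le (Finset.filter_subset _ _) (by omega)
  refine ⟨?_, ?_, ?_⟩
  · rintro (i | j)
    · have : i ∈ F := by simp [hF]
      exact lt_of_le_of_ne (hc _) (Ne.symm (Finset.mem_filter.1 this).2)
    · have : j ∈ G := by simp [hG]
      exact lt_of_le_of_ne (hc _) (Ne.symm (Finset.mem_filter.1 this).2)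
  · have : Set.InjOn x G := Finset.card_image_iff.1 (show I.card = G.card by omega)
    rw [hG] at this
    simpa [Set.injOn_univ] using this
  · intro j
    have : x j ∈ J := by
      rw [hJI]
      exact Finset.mem_image_of_mem x (by simp [hG])
    exact (Finset.mem_filter.1 this).2

/-- Two representations of one point give a linear relation among at most p + 2k = n + 1 lifted
curve points, hence a trivial one. -/
lemma conePoint_injective (hγ : IsTotallyPosCurve γ a b) (hab : a < b)
    (h : p + k + k = n + 1) {e : Fin p → ℝ} (he : ∀ i, e i = a ∨ e i = b)
    (hei : Function.Injective e) {c c' : Fin p ⊕ Fin k → ℝ} {x x' : Fin k → ℝ}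
    (hc : ∀ q, 0 < c q) (hc' : ∀ q, 0 < c' q) (hx : StrictMono x) (hx' : StrictMono x')
    (hxI : ∀ j, x j ∈ Ioo a b) (hxI' : ∀ j, x' j ∈ Ioo a b)
    (heq : conePoint γ e c x = conePoint γ e c' x') : c = c' ∧ x = x' := by
  classical
  have heI : ∀ i, e i ∈ Icc a b := fun i => by
    rcases he i with hi | hi <;> rw [hi]
    exacts [left_mem_Icc.2 hab.le, right_mem_Icc.2 hab.le]
  have heI' : ∀ i, e i ∉ Ioo a b := fun i => by
    rcases he i with hi | hi <;> rw [hi] <;> simp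
  let N : Finset ℝ := Finset.univ.image e ∪ Finset.univ.image x ∪ Finset.univ.image x'
  have hNc : N.card ≤ n + 1 := by
    have h1 : (Finset.univ.image e).card ≤ p := Finset.card_image_le.trans_eq (by simp)
    have h2 : (Finset.univ.image x).card ≤ k := Finset.card_image_le.trans_eq (by simp)
    have h3 : (Finset.univ.image x').card ≤ k := Finset.card_image_le.trans_eq (by simp)
    have h4 : N.card ≤ _ := Finset.card_union_le _ _
    have h5 := Finset.card_union_le (Finset.univ.image e) (Finset.univ.image x)
    omega
  have hNI : ∀ t ∈ N, t ∈ Icc a b := by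
    intro t ht
    simp only [N, Finset.mem_union, Finset.mem_image, Finset.mem_univ, true_and] at ht
    rcases ht with (⟨i, rfl⟩ | ⟨i, rfl⟩) | ⟨i, rfl⟩
    exacts [heI i, Ioo_subset_Icc_self (hxI i), Ioo_subset_Icc_self (hxI' i)]
  have hzN : ∀ q, Sum.elim e x q ∈ N := by rintro (i | i) <;> simp [N]
  have hzN' : ∀ q, Sum.elim e x' q ∈ N := by rintro (i | i) <;> simp [N]
  -- The total weight that a representation puts at the parameter t.
  let m : (Fin p ⊕ Fin k → ℝ) → (Fin p ⊕ Fin k → ℝ) → ℝ → ℝ := fun z c t =>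
    ∑ q, if z q = t then c q else 0
  have hm : ∀ z c : Fin p ⊕ Fin k → ℝ, (∀ q, z q ∈ N) →
      ∑ t ∈ N, m z c t • homCoord (γ t) = ∑ q, c q • homCoord (γ (z q)) := by
    intro z c hz
    simp only [m, Finset.sum_smul]
    rw [Finset.sum_comm]
    refine Finset.sum_congr rfl fun q _ => ?_
    simp [ite_smul, hz q]
  have hα := hγ.eq_zero_of_sum_homCoord N hNI hNc
    (fun t => m (Sum.elim e x) c t - m (Sum.elim e x') c' t) (by
      simp only [sub_smul, Finset.sum_sub_distrib]
      rw [hm _ _ hzN, hm _ _ hzN']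
      exact sub_eq_zero.2 heq)
  have hinj : ∀ x : Fin k → ℝ, StrictMono x → (∀ j, x j ∈ Ioo a b) →
      Function.Injective (Sum.elim e x) := fun x hx hxI =>
    hei.sumElim hx.injective fun i j hij => heI' i (hij ▸ hxI j)
  have hmz : ∀ z c : Fin p ⊕ Fin k → ℝ, Function.Injective z → ∀ q, m z c (z q) = c q := by
    intro z c hz q
    simp only [m, hz.eq_iff, Finset.sum_ite_eq', Finset.mem_univ, if_true]
  have hmem : ∀ z c : Fin p ⊕ Fin k → ℝ, ∀ t, m z c t ≠ 0 → ∃ q, z q = t := by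
    intro z c t ht
    by_contra hcon
    push Not at hcon
    exact ht (Finset.sum_eq_zero fun q _ => by simp [hcon q])
  have hsub : range x ⊆ range x' := by
    rintro _ ⟨j, rfl⟩
    have h1 := hα _ (hzN (.inr j))
    simp only [hmz _ c (hinj x hx hxI) (.inr j)] at h1
    obtain ⟨q, hq⟩ := hmem (Sum.elim e x') c' (Sum.elim e x (.inr j))
      (by have := hc (.inr j); intro h0; rw [h0] at h1; linarith)
    rcases q with i | i
    · have hq' : e i = x j := hq
      exact absurd (hxI j) (hq' ▸ heI' i)
    · exact ⟨i, by simpa using hq⟩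
  have hsub' : range x' ⊆ range x := by
    rintro _ ⟨j, rfl⟩
    have h1 := hα _ (hzN' (.inr j))
    simp only [hmz _ c' (hinj x' hx' hxI') (.inr j)] at h1
    obtain ⟨q, hq⟩ := hmem (Sum.elim e x) c (Sum.elim e x' (.inr j))
      (by have := hc' (.inr j); intro h0; rw [h0] at h1; linarith)
    rcases q with i | i
    · have hq' : e i = x' j := hq
      exact absurd (hxI' j) (hq' ▸ heI' i)
    · exact ⟨i, by simpa using hq⟩
  have hxx : x = x' := (hx.range_inj hx').1 (hsub.antisymm hsub')
  subst hxx
  refine ⟨?_, rfl⟩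
  ext q
  have h1 := hα _ (hzN q)
  simp only [hmz _ _ (hinj x hx hxI) q] at h1
  linarith

end IsTotallyPosCurve

/-! ### The parametrisation of the interior of the cone. -/

/-- The strictly ordered simplex `{x ∈ ℝᵏ : a < x₁ < ⋯ < xₖ < b}`. -/
def openSimplex (a b : ℝ) (k : ℕ) : Set (Fin k → ℝ) :=
  {x | StrictMono x ∧ ∀ j, x j ∈ Ioo a b}

lemma isOpen_openSimplex (a b : ℝ) (k : ℕ) : IsOpen (openSimplex a b k) := by
  have : openSimplex a b k =
      (⋂ i : Fin k, ⋂ j : Fin k, {x : Fin k → ℝ | i < j → x i < x j}) ∩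
        ⋂ j : Fin k, {x : Fin k → ℝ | x j ∈ Ioo a b} := by
    ext x
    simp [openSimplex, StrictMono]
  rw [this]
  refine IsOpen.inter (isOpen_iInter_of_finite fun i => isOpen_iInter_of_finite fun j => ?_)
    (isOpen_iInter_of_finite fun j => isOpen_Ioo.preimage (continuous_apply j))
  by_cases hij : i < j
  · simpa [hij] using isOpen_lt (continuous_apply i) (continuous_apply j)
  · simp [hij]

lemma openSimplex_nonempty {a b : ℝ} (hab : a < b) (k : ℕ) : (openSimplex a b k).Nonempty := by
  refine ⟨fun j => a + (b - a) * ((j + 1 : ℝ) / (k + 1)), ?_, fun j => ⟨?_, ?_⟩⟩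
  · intro i j hij
    have : (i : ℝ) < j := by exact_mod_cast hij
    have := sub_pos.2 hab
    dsimp only
    gcongr
  · have := mul_pos (sub_pos.2 hab) (show (0 : ℝ) < ((j : ℕ) + 1 : ℝ) / (k + 1) by positivity)
    linarith
  · have h1 : ((j : ℕ) + 1 : ℝ) / (k + 1) < 1 := by
      rw [div_lt_one (by positivity)]
      have : ((j : ℕ) : ℝ) < k := by exact_mod_cast j.2
      linarith
    have := mul_lt_mul_of_pos_left h1 (sub_pos.2 hab)
    linarith

section ConeMap

variable {n p k : ℕ}

/-- `conePoint` as a map of `ℝⁿ⁺¹` to itself. -/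
noncomputable def coneMap (h : p + k + k = n + 1) (γ : ℝ → Fin n → ℝ) (e : Fin p → ℝ)
    (v : Fin (n + 1) → ℝ) : Fin (n + 1) → ℝ :=
  conePoint γ e (fun q => v (blockEquiv h (.inl q))) (fun j => v (blockEquiv h (.inr j)))

/-- Positive weights and strictly ordered parameters. -/
def coneDomain (h : p + k + k = n + 1) (a b : ℝ) : Set (Fin (n + 1) → ℝ) :=
  {v | (∀ q, 0 < v (blockEquiv h (.inl q))) ∧
    (fun j => v (blockEquiv h (.inr j))) ∈ openSimplex a b k}

/-- The Jacobian matrix of `coneMap`. -/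
noncomputable def coneJacobian (h : p + k + k = n + 1) (γ : ℝ → Fin n → ℝ) (e : Fin p → ℝ)
    (v : Fin (n + 1) → ℝ) : Matrix (Fin (n + 1)) (Fin (n + 1)) ℝ :=
  Matrix.of fun i j =>
    Sum.elim (fun _ => 1) (fun j' => v (blockEquiv h (.inl (.inr j')))) ((blockEquiv h).symm j) *
      (confluentMatrix γ e (fun j => v (blockEquiv h (.inr j)))).submatrix id (blockEquiv h).symm i j

lemma det_coneJacobian (h : p + k + k = n + 1) (γ : ℝ → Fin n → ℝ) (e : Fin p → ℝ)
    (v : Fin (n + 1) → ℝ) : (coneJacobian h γ e v).det =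
      (∏ j, v (blockEquiv h (.inl (.inr j)))) *
        confluentDet h γ e (fun j => v (blockEquiv h (.inr j))) := by
  rw [coneJacobian, Matrix.det_mul_row, confluentDet]
  congr 1
  rw [← (blockEquiv h).prod_comp]
  simp

lemma isOpen_coneDomain (h : p + k + k = n + 1) (a b : ℝ) : IsOpen (coneDomain h a b) := by
  have hx : Continuous fun (v : Fin (n + 1) → ℝ) (j : Fin k) => v (blockEquiv h (.inr j)) :=
    continuous_pi fun j => continuous_apply _
  have : coneDomain h a b = (⋂ q, {v : Fin (n + 1) → ℝ | 0 < v (blockEquiv h (.inl q))}) ∩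
      (fun (v : Fin (n + 1) → ℝ) (j : Fin k) => v (blockEquiv h (.inr j))) ⁻¹'
        openSimplex a b k := by
    ext; simp [coneDomain]
  rw [this]
  exact (isOpen_iInter_of_finite fun q => isOpen_lt continuous_const (continuous_apply _)).inter
    ((isOpen_openSimplex a b k).preimage hx)

lemma hasStrictFDerivAt_coneMap (h : p + k + k = n + 1) {γ : ℝ → Fin n → ℝ} (e : Fin p → ℝ)
    {a b : ℝ} (hγ : ∀ t ∈ Ioo a b, HasStrictDerivAt γ (deriv γ t) t) {v : Fin (n + 1) → ℝ}
    (hv : ∀ j, v (blockEquiv h (.inr j)) ∈ Ioo a b) :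
    HasStrictFDerivAt (coneMap h γ e)
      (LinearMap.toContinuousLinearMap (Matrix.toLin' (coneJacobian h γ e v))) v := by
  have hhat : ∀ t ∈ Ioo a b, ∀ i, HasStrictDerivAt (fun t => homCoord (γ t) i)
      (homDir (deriv γ t) i) t := by
    intro t ht i
    refine Fin.cases ?_ (fun i => ?_) i
    · exact hasStrictDerivAt_const t (1 : ℝ)
    · exact hasStrictDerivAt_pi.1 (hγ t ht) i
  rw [hasStrictFDerivAt_pi']
  intro r
  have hproj : ∀ c, HasStrictFDerivAt (fun v : Fin (n + 1) → ℝ => v c)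
      (ContinuousLinearMap.proj (R := ℝ) (φ := fun _ : Fin (n + 1) => ℝ) c) v :=
    fun c => (ContinuousLinearMap.proj (R := ℝ) (φ := fun _ : Fin (n + 1) => ℝ) c).hasStrictFDerivAt
  have h1 := HasStrictFDerivAt.fun_sum (u := Finset.univ) fun (i : Fin p) _ =>
    (hproj (blockEquiv h (.inl (.inl i)))).mul_const (homCoord (γ (e i)) r)
  have h2 := HasStrictFDerivAt.fun_sum (u := Finset.univ) fun (j : Fin k) _ =>
    (hproj (blockEquiv h (.inl (.inr j)))).mul
      ((hhat _ (hv j) r).comp_hasStrictFDerivAt v (hproj (blockEquiv h (.inr j))))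
  have h3 := h1.add h2
  refine (h3.congr_fderiv ?_).congr_of_eventuallyEq ?_
  · ext w
    simp only [ContinuousLinearMap.comp_apply, ContinuousLinearMap.proj_apply,
      LinearMap.coe_toContinuousLinearMap', Matrix.toLin'_apply, Matrix.mulVec, dotProduct]
    rw [← (blockEquiv h).sum_comp]
    simp [coneJacobian, confluentMatrix, Fintype.sum_sum_type, Finset.sum_add_distrib]
    rw [add_assoc]
    congr 1
    rw [add_comm]
    congr 1
    exact Finset.sum_congr rfl fun i _ => by ring
  · refine Filter.Eventually.of_forall fun w => ?_
    simp [coneMap, conePoint, Fintype.sum_sum_type]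

end ConeMap

namespace IsTotallyPosCurve

variable {n p k : ℕ} {γ : ℝ → Fin n → ℝ} {a b : ℝ}

/-- The Jacobian determinant is nonzero on the domain, so the map is locally open. -/
lemma isOpen_coneMap_image (hγ : IsTotallyPosCurve γ a b) (hab : a < b)
    (hd : ∀ t ∈ Ioo a b, HasStrictDerivAt γ (deriv γ t) t)
    (h : p + k + k = n + 1) {e : Fin p → ℝ} (he : ∀ i, e i = a ∨ e i = b)
    (hei : Function.Injective e) : IsOpen (coneMap h γ e '' coneDomain h a b) := by
  rw [isOpen_iff_mem_nhds]
  rintro _ ⟨v, hv, rfl⟩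
  have heI : ∀ i, e i ∈ Icc a b := fun i => by
    rcases he i with hi | hi <;> rw [hi]
    exacts [left_mem_Icc.2 hab.le, right_mem_Icc.2 hab.le]
  have heI' : ∀ i, e i ∉ Ioo a b := fun i => by
    rcases he i with hi | hi <;> rw [hi] <;> simp
  have hdet : (coneJacobian h γ e v).det ≠ 0 := by
    rw [det_coneJacobian]
    refine mul_ne_zero (Finset.prod_ne_zero_iff.2 fun j _ => (hv.1 _).ne')
      (hγ.isPosCurve.confluentDet_ne_zero h heI hv.2.2 ?_)
    exact hei.sumElim hv.2.1.injective fun i j hij => heI' i (hij ▸ hv.2.2 j)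
  have hs := hasStrictFDerivAt_coneMap h e hd hv.2.2
  have hsurj : (LinearMap.toContinuousLinearMap
      (Matrix.toLin' (coneJacobian h γ e v))).range = ⊤ := by
    rw [LinearMap.range_eq_top]
    exact Matrix.mulVec_surjective_iff_isUnit.2
      ((Matrix.isUnit_iff_isUnit_det _).2 (isUnit_iff_ne_zero.2 hdet))
  rw [← hs.map_nhds_eq_of_surj hsurj]
  exact Filter.image_mem_map ((isOpen_coneDomain h a b).mem_nhds hv)

/-- The image is nonempty, open, and relatively closed in the interior of the cone, which is convex
and therefore connected. -/
theorem coneMap_image (hγ : IsTotallyPosCurve γ a b) (hab : a < b)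
    (hd : ∀ t ∈ Ioo a b, HasStrictDerivAt γ (deriv γ t) t)
    (h : p + k + k = n + 1) {e : Fin p → ℝ} (he : ∀ i, e i = a ∨ e i = b)
    (hei : Function.Injective e) : coneMap h γ e '' coneDomain h a b =
      interior (coneOver (convexHull ℝ (γ '' Icc a b))) := by
  have heI : ∀ i, e i ∈ Icc a b := fun i => by
    rcases he i with hi | hi <;> rw [hi]
    exacts [left_mem_Icc.2 hab.le, right_mem_Icc.2 hab.le]
  have hopen := hγ.isOpen_coneMap_image hab hd h he hei
  have hne : Nonempty (Fin p ⊕ Fin k) := by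
    rcases Nat.eq_zero_or_pos k with hk | hk
    · exact ⟨.inl ⟨0, by omega⟩⟩
    · exact ⟨.inr ⟨0, hk⟩⟩
  have hsub : coneMap h γ e '' coneDomain h a b ⊆
      interior (coneOver (convexHull ℝ (γ '' Icc a b))) := by
    refine interior_maximal ?_ hopen
    rintro _ ⟨v, hv, rfl⟩
    exact conePoint_mem_coneOver heI (fun q => (hv.1 q).le)
      (Finset.sum_pos (fun q _ => hv.1 q) Finset.univ_nonempty)
      fun j => Ioo_subset_Icc_self (hv.2.2 j)
  refine hsub.antisymm ?_
  have hconn : IsPreconnected (interior (coneOver (convexHull ℝ (γ '' Icc a b)))) :=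
    (convex_coneOver (convex_convexHull ℝ _)).interior.isPreconnected
  refine hconn.subset_of_closure_inter_subset hopen ?_ ?_
  · obtain ⟨x, hx⟩ := openSimplex_nonempty hab k
    have hmem : (Sum.elim (fun _ => 1) x ∘ (blockEquiv h).symm) ∈ coneDomain h a b := by
      refine ⟨fun q => by simp, ?_⟩
      simpa using hx
    exact ⟨_, hsub (mem_image_of_mem _ hmem), mem_image_of_mem _ hmem⟩
  · rintro y ⟨hycl, hyint⟩
    -- The height is the sum of the weights, so near y all weights are at most R and the parameters
    -- stay in the compact set Q. Thus y has a possibly degenerate representation, and nondegeneracy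
    -- puts it back in the open domain.
    let R := y 0 + 1
    let Q : Set (Fin (n + 1) → ℝ) := {v | (∀ q, v (blockEquiv h (.inl q)) ∈ Icc 0 R) ∧
      Monotone (fun j => v (blockEquiv h (.inr j))) ∧ ∀ j, v (blockEquiv h (.inr j)) ∈ Icc a b}
    have hQclosed : IsClosed Q := by
      have : Q = (⋂ q, {v : Fin (n + 1) → ℝ | v (blockEquiv h (.inl q)) ∈ Icc 0 R}) ∩
          ((⋂ i : Fin k, ⋂ j : Fin k, {v : Fin (n + 1) → ℝ | i ≤ j →
            v (blockEquiv h (.inr i)) ≤ v (blockEquiv h (.inr j))}) ∩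
          ⋂ j : Fin k, {v : Fin (n + 1) → ℝ | v (blockEquiv h (.inr j)) ∈ Icc a b}) := by
        ext v
        simp [Q, Monotone]
      rw [this]
      refine IsClosed.inter (isClosed_iInter fun q => isClosed_Icc.preimage (continuous_apply _))
        (IsClosed.inter (isClosed_iInter fun i => isClosed_iInter fun j => ?_)
        (isClosed_iInter fun j => isClosed_Icc.preimage (continuous_apply _)))
      by_cases hij : i ≤ j
      · simpa [hij] using isClosed_le (continuous_apply (blockEquiv h (.inr i)))
          (continuous_apply (blockEquiv h (.inr j)))
      · simp [hij]
    have hQ : IsCompact Q := by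
      refine IsCompact.of_isClosed_subset (isCompact_Icc (a := fun _ => min 0 a)
        (b := fun _ => max R b)) hQclosed fun v hv => ?_
      have : ∀ c, v (blockEquiv h c) ∈ Icc (min 0 a) (max R b) := by
        rintro (q | j)
        · exact ⟨(min_le_left _ _).trans (hv.1 q).1, (hv.1 q).2.trans (le_max_left _ _)⟩
        · exact ⟨(min_le_right _ _).trans (hv.2.2 j).1, (hv.2.2 j).2.trans (le_max_right _ _)⟩
      exact ⟨fun i => by simpa using (this ((blockEquiv h).symm i)).1,
        fun i => by simpa using (this ((blockEquiv h).symm i)).2⟩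
    have hcontQ : ContinuousOn (coneMap h γ e) Q := by
      have hcoord : ∀ i, ContinuousOn (fun v : Fin (n + 1) → ℝ => v i) Q :=
        fun i => (continuous_apply i).continuousOn
      change ContinuousOn (fun v : Fin (n + 1) → ℝ => ∑ q, v (blockEquiv h (.inl q)) •
        homCoord (γ (Sum.elim e (fun j => v (blockEquiv h (.inr j))) q))) Q
      refine continuousOn_finsetSum _ fun q _ => (hcoord _).smul ?_
      rcases q with i | j
      · exact continuousOn_const (c := homCoord (γ (e i)))
      · exact hγ.isPosCurve.continuousOn_homCoord.comp (hcoord (blockEquiv h (.inr j)))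
          fun v hv => hv.2.2 j
    have hyQ : y ∈ coneMap h γ e '' Q := by
      have hO : IsOpen {z : Fin (n + 1) → ℝ | z 0 < R} :=
        isOpen_lt (continuous_apply 0) continuous_const
      have hycl' : y ∈ closure ({z : Fin (n + 1) → ℝ | z 0 < R} ∩
          coneMap h γ e '' coneDomain h a b) :=
        hO.inter_closure ⟨show y 0 < R by simp [R], hycl⟩
      refine closure_minimal ?_ (hQ.image_of_continuousOn hcontQ).isClosed hycl'
      rintro _ ⟨hz, v, hv, rfl⟩
      refine ⟨v, ⟨fun q => ⟨(hv.1 q).le, ?_⟩, hv.2.1.monotone,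
        fun j => Ioo_subset_Icc_self (hv.2.2 j)⟩, rfl⟩
      have hz' : ∑ q, v (blockEquiv h (.inl q)) < R := by
        have : coneMap h γ e v 0 < R := hz
        rwa [coneMap, conePoint_zero] at this
      exact (Finset.single_le_sum (f := fun q => v (blockEquiv h (.inl q)))
        (fun q _ => (hv.1 q).le) (Finset.mem_univ q)).trans hz'.le
    obtain ⟨v, hv, rfl⟩ := hyQ
    obtain ⟨h1, h2, h3⟩ := hγ.nondegenerate_of_conePoint_mem_interior hab h he
      (fun q => (hv.1 q).1) hv.2.2 hyint
    exact ⟨v, ⟨h1, hv.2.1.strictMono_of_injective h2, h3⟩, rfl⟩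

lemma injOn_coneMap (hγ : IsTotallyPosCurve γ a b) (hab : a < b)
    (h : p + k + k = n + 1) {e : Fin p → ℝ} (he : ∀ i, e i = a ∨ e i = b)
    (hei : Function.Injective e) : InjOn (coneMap h γ e) (coneDomain h a b) := by
  intro v hv v' hv' heq
  obtain ⟨h1, h2⟩ := hγ.conePoint_injective hab h he hei hv.1 hv'.1 hv.2.1 hv'.2.1 hv.2.2 hv'.2.2 heq
  ext i
  obtain ⟨c, rfl⟩ := (blockEquiv h).surjective i
  rcases c with q | j
  · exact congrFun h1 q
  · exact congrFun h2 j

end IsTotallyPosCurve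

/-! ### The exponentially weighted volume of the cone. -/

lemma measurableSet_coneOver {n : ℕ} {K : Set (Fin n → ℝ)} (hK : MeasurableSet K) :
    MeasurableSet (coneOver K) := by
  have h1 : Measurable fun y : Fin (n + 1) → ℝ => (y 0)⁻¹ • fun i : Fin n => y i.succ :=
    (measurable_pi_apply 0).inv.smul (measurable_pi_lambda _ fun i => measurable_pi_apply _)
  exact (measurableSet_lt measurable_const (measurable_pi_apply 0)).inter (h1 hK)

lemma lintegral_Ioi_exp_neg_mul_pow (n : ℕ) :
    ∫⁻ s in Ioi (0 : ℝ), ENNReal.ofReal (Real.exp (-s) * s ^ n) = (n.factorial : ENNReal) := by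
  have hpos : (0 : ℝ) < n + 1 := by positivity
  have h1 := Real.Gamma_eq_integral hpos
  have h2 := Real.GammaIntegral_convergent hpos
  simp only [add_sub_cancel_right, Real.rpow_natCast] at h1 h2
  rw [← ofReal_integral_eq_lintegral_ofReal h2, ← h1, Real.Gamma_nat_eq_factorial,
    ENNReal.ofReal_natCast]
  filter_upwards [ae_restrict_mem measurableSet_Ioi] with s hs
  have : (0 : ℝ) < s := hs
  positivity

lemma integrableOn_exp_neg_mul_pow (n : ℕ) :
    IntegrableOn (fun s : ℝ => Real.exp (-s) * s ^ n) (Ioi 0) := by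
  have h2 := Real.GammaIntegral_convergent (show (0 : ℝ) < n + 1 by positivity)
  simpa only [add_sub_cancel_right, Real.rpow_natCast] using h2

lemma integral_exp_neg_mul_pow (n : ℕ) :
    ∫ s in Ioi (0 : ℝ), Real.exp (-s) * s ^ n = n.factorial := by
  have h1 := Real.Gamma_eq_integral (show (0 : ℝ) < n + 1 by positivity)
  simp only [add_sub_cancel_right, Real.rpow_natCast] at h1
  rw [← h1, Real.Gamma_nat_eq_factorial]

/-- The slice at height s is sK, of volume sⁿ Vol(K), and ∫ e^{-s} sⁿ ds = n!. -/
lemma lintegral_coneOver_of_measurableSet {n : ℕ} {K : Set (Fin n → ℝ)} (hK : MeasurableSet K) :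
    ∫⁻ y in coneOver K, ENNReal.ofReal (Real.exp (-y 0)) = n.factorial * volume K := by
  let F : (Fin (n + 1) → ℝ) → ENNReal :=
    (coneOver K).indicator fun y => ENNReal.ofReal (Real.exp (-y 0))
  have hF : Measurable F := Measurable.indicator (by fun_prop) (measurableSet_coneOver hK)
  let E := MeasurableEquiv.piFinSuccAbove (fun _ : Fin (n + 1) => ℝ) 0
  have hE : MeasurePreserving E.symm := (volume_preserving_piFinSuccAbove (fun _ => ℝ) 0).symm
  rw [← lintegral_indicator (measurableSet_coneOver hK)]
  change ∫⁻ y, F y = _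
  rw [← hE.lintegral_comp_emb E.symm.measurableEmbedding F, Measure.volume_eq_prod,
    lintegral_prod (fun z => F (E.symm z)) (hF.comp E.symm.measurable).aemeasurable]
  have hmem : ∀ (s : ℝ) (w : Fin n → ℝ), E.symm (s, w) ∈ coneOver K ↔ 0 < s ∧ s⁻¹ • w ∈ K :=
    fun s w => Iff.rfl
  have h0 : ∀ (s : ℝ) (w : Fin n → ℝ), E.symm (s, w) 0 = s := fun s w => rfl
  have hin : ∀ s : ℝ, ∫⁻ w : Fin n → ℝ, F (E.symm (s, w)) =
      (Ioi (0 : ℝ)).indicator (fun s => ENNReal.ofReal (Real.exp (-s) * s ^ n) * volume K) s := by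
    intro s
    by_cases hs : 0 < s
    · rw [indicator_of_mem (mem_Ioi.2 hs)]
      have h1 : ∀ w : Fin n → ℝ, F (E.symm (s, w)) =
          ((fun w : Fin n → ℝ => s⁻¹ • w) ⁻¹' K).indicator
            (fun _ => ENNReal.ofReal (Real.exp (-s))) w := by
        intro w
        by_cases hw : s⁻¹ • w ∈ K
        · rw [indicator_of_mem (show w ∈ (fun w : Fin n → ℝ => s⁻¹ • w) ⁻¹' K from hw)]
          simp only [F]
          rw [indicator_of_mem ((hmem s w).2 ⟨hs, hw⟩), h0]
        · rw [indicator_of_notMem (show w ∉ (fun w : Fin n → ℝ => s⁻¹ • w) ⁻¹' K from hw)]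
          simp only [F]
          rw [indicator_of_notMem fun hh => hw ((hmem s w).1 hh).2]
      simp only [h1]
      have hmeas : MeasurableSet ((fun w : Fin n → ℝ => s⁻¹ • w) ⁻¹' K) :=
        (measurable_const_smul s⁻¹) hK
      rw [lintegral_indicator_const hmeas, Measure.addHaar_preimage_smul _ (inv_ne_zero hs.ne'),
        ← mul_assoc, ENNReal.ofReal_mul (Real.exp_pos _).le]
      congr 3
      simp [abs_of_pos hs]
    · rw [indicator_of_notMem (by simpa using hs)]
      refine (lintegral_congr fun w => ?_).trans lintegral_zero
      simp only [F]
      exact indicator_of_notMem (fun hh => hs ((hmem s w).1 hh).1) _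
  simp only [hin]
  rw [lintegral_indicator measurableSet_Ioi, lintegral_mul_const _ (by fun_prop),
    lintegral_Ioi_exp_neg_mul_pow]

lemma coneOver_mono {n : ℕ} {K K' : Set (Fin n → ℝ)} (h : K ⊆ K') : coneOver K ⊆ coneOver K' :=
  fun _ hy => ⟨hy.1, h hy.2⟩

/-- The exponentially weighted volume of the cone over a convex set. -/
lemma lintegral_interior_coneOver {n : ℕ} {K : Set (Fin n → ℝ)} (hK : Convex ℝ K) :
    ∫⁻ y in interior (coneOver K), ENNReal.ofReal (Real.exp (-y 0)) =
      n.factorial * volume K := by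
  have hfr := hK.addHaar_frontier volume
  rw [Measure.restrict_congr_set (interior_ae_eq_of_null_frontier
    ((convex_coneOver hK).addHaar_frontier volume))]
  -- K is not assumed measurable; it is squeezed between its interior and its closure, which differ
  -- by a null set.
  refine le_antisymm ?_ ?_
  · refine (lintegral_mono_set (coneOver_mono subset_closure)).trans_eq ?_
    rw [lintegral_coneOver_of_measurableSet isClosed_closure.measurableSet,
      measure_congr (closure_ae_eq_of_null_frontier hfr)]
  · refine le_trans (le_of_eq ?_) (lintegral_mono_set (coneOver_mono interior_subset))
    rw [lintegral_coneOver_of_measurableSet isOpen_interior.measurableSet,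
      measure_congr (interior_ae_eq_of_null_frontier hfr)]

/-- Exponent 1 comes from the Jacobian factor at moving points; both 0! and 1! equal 1. -/
lemma lintegral_weights (p k : ℕ) :
    ∫⁻ c : Fin p ⊕ Fin k → ℝ, ENNReal.ofReal (∏ q, (Ioi (0 : ℝ)).indicator
      (fun s => Real.exp (-s) * s ^ (Sum.elim (fun _ => 0) (fun _ => 1) q : ℕ)) (c q)) = 1 := by
  let f : Fin p ⊕ Fin k → ℝ → ℝ := fun q => (Ioi (0 : ℝ)).indicator
      (fun s => Real.exp (-s) * s ^ (Sum.elim (fun _ => 0) (fun _ => 1) q : ℕ))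
  have hint : ∀ q, Integrable (f q) := fun q =>
    (integrable_indicator_iff measurableSet_Ioi).2 (integrableOn_exp_neg_mul_pow _)
  have hnn : ∀ q s, 0 ≤ f q s := fun q s => indicator_nonneg (fun s hs => by
    have : (0 : ℝ) < s := hs
    positivity) s
  have h1 : ∫ c : Fin p ⊕ Fin k → ℝ, ∏ q, f q (c q) = 1 := by
    rw [integral_fintype_prod_volume_eq_prod]
    refine Finset.prod_eq_one fun q _ => ?_
    simp only [f]
    rw [integral_indicator measurableSet_Ioi, integral_exp_neg_mul_pow]
    rcases q with q | q <;> simp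
  change ∫⁻ c : Fin p ⊕ Fin k → ℝ, ENNReal.ofReal (∏ q, f q (c q)) = 1
  have hI : Integrable (fun c : Fin p ⊕ Fin k → ℝ => ∏ q, f q (c q)) :=
    Integrable.fintype_prod hint
  rw [← ofReal_integral_eq_lintegral_ofReal hI
    (Filter.Eventually.of_forall fun c => Finset.prod_nonneg fun q _ => hnn q _), h1,
    ENNReal.ofReal_one]

/-! ### Change of variables. -/

section

variable {n p k : ℕ} {γ : ℝ → Fin n → ℝ} {a b : ℝ}

lemma continuousOn_confluentDet (hγ : ContDiffOn ℝ 1 γ (Ioo a b)) (h : p + k + k = n + 1)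
    (e : Fin p → ℝ) : ContinuousOn (confluentDet h γ e) (openSimplex a b k) := by
  have hcont : Continuous fun M : Matrix (Fin (n + 1)) ((Fin p ⊕ Fin k) ⊕ Fin k) ℝ =>
      (M.submatrix id (blockEquiv h).symm).det :=
    (continuous_id.matrix_submatrix _ _).matrix_det
  have hd : ContinuousOn (deriv γ) (Ioo a b) := hγ.continuousOn_deriv_of_isOpen isOpen_Ioo le_rfl
  refine hcont.comp_continuousOn ?_
  refine continuousOn_pi.2 fun i => continuousOn_pi.2 fun c => ?_
  have hcoord : ∀ j, ContinuousOn (fun x : Fin k → ℝ => x j) (openSimplex a b k) :=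
    fun j => (continuous_apply j).continuousOn
  rcases c with (c | j) | j
  · exact continuousOn_const
  · refine Fin.cases continuousOn_const (fun i => ?_) i
    exact (continuousOn_pi.1 hγ.continuousOn i).comp (hcoord j) fun x hx => hx.2 j
  · refine Fin.cases continuousOn_const (fun i => ?_) i
    exact (continuousOn_pi.1 hd i).comp (hcoord j) fun x hx => hx.2 j

/-- Evaluates the exponentially weighted volume through `coneMap`, where the integrand is a function
of the weights times a function of x. -/
theorem IsTotallyPosCurve.factorial_mul_volume_convexHull (hγ : IsTotallyPosCurve γ a b)
    (hab : a < b) (hC : ContDiffOn ℝ 1 γ (Ioo a b)) (h : p + k + k = n + 1) {e : Fin p → ℝ}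
    (he : ∀ i, e i = a ∨ e i = b) (hei : Function.Injective e) :
    n.factorial * volume (convexHull ℝ (γ '' Icc a b)) =
      ∫⁻ x in openSimplex a b k, ENNReal.ofReal |confluentDet h γ e x| := by
  have hd : ∀ t ∈ Ioo a b, HasStrictDerivAt γ (deriv γ t) t := fun t ht =>
    (hC.contDiffAt (isOpen_Ioo.mem_nhds ht)).hasStrictDerivAt (by simp)
  have hDm := (isOpen_coneDomain (n := n) h a b).measurableSet
  have hSm := (isOpen_openSimplex a b k).measurableSet
  rw [← lintegral_interior_coneOver (convex_convexHull ℝ _), ← hγ.coneMap_image hab hd h he hei,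
    lintegral_image_eq_lintegral_abs_det_fderiv_mul volume hDm
      (fun v hv => (hasStrictFDerivAt_coneMap h e hd hv.2.2).hasFDerivAt.hasFDerivWithinAt)
      (hγ.injOn_coneMap hab h he hei), ← lintegral_indicator hDm, ← lintegral_indicator hSm]
  let G : (Fin p ⊕ Fin k → ℝ) → ENNReal := fun c => ENNReal.ofReal (∏ q,
    (Ioi (0 : ℝ)).indicator
      (fun s => Real.exp (-s) * s ^ (Sum.elim (fun _ => 0) (fun _ => 1) q : ℕ)) (c q))
  let H : (Fin k → ℝ) → ENNReal :=
    (openSimplex a b k).indicator fun x => ENNReal.ofReal |confluentDet h γ e x|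
  let T := (MeasurableEquiv.piCongrLeft (fun _ : Fin (n + 1) => ℝ) (blockEquiv h)).symm.trans
    (MeasurableEquiv.sumPiEquivProdPi fun _ => ℝ)
  have hT : MeasurePreserving T := (volume_measurePreserving_sumPiEquivProdPi _).comp
    (volume_measurePreserving_piCongrLeft (fun _ : Fin (n + 1) => ℝ) (blockEquiv h)).symm
  have hGm : Measurable G := by
    refine ENNReal.measurable_ofReal.comp (Finset.measurable_prod _ fun q _ => ?_)
    exact (Measurable.indicator (by fun_prop) measurableSet_Ioi).comp (measurable_pi_apply q)
  have hHm : AEMeasurable H := (aemeasurable_indicator_iff hSm).2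
    (((continuousOn_confluentDet hC h e).abs.aemeasurable hSm).ennreal_ofReal)
  have hprod : ∫⁻ z : (Fin p ⊕ Fin k → ℝ) × (Fin k → ℝ), G z.1 * H z.2 = ∫⁻ x, H x := by
    rw [Measure.volume_eq_prod, lintegral_prod_mul hGm.aemeasurable hHm]
    have : ∫⁻ c, G c = 1 := lintegral_weights p k
    rw [this, one_mul]
  change _ = ∫⁻ x, H x
  rw [← hprod, ← hT.lintegral_comp_emb T.measurableEmbedding]
  refine lintegral_congr fun v => ?_
  have hT1 : (T v).1 = fun q => v (blockEquiv h (.inl q)) := rfl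
  have hT2 : (T v).2 = fun j => v (blockEquiv h (.inr j)) := rfl
  rw [hT1, hT2]
  -- Outside the domain one of the two factors vanishes, so the identity extends to all of ℝⁿ⁺¹ and
  -- Tonelli applies.
  by_cases hv2 : (fun j => v (blockEquiv h (.inr j))) ∈ openSimplex a b k
  swap
  · rw [indicator_of_notMem fun hh : v ∈ coneDomain h a b => hv2 hh.2]
    simp only [H]
    rw [indicator_of_notMem hv2, mul_zero]
  by_cases hv1 : ∀ q, 0 < v (blockEquiv h (.inl q))
  swap
  · rw [indicator_of_notMem fun hh : v ∈ coneDomain h a b => hv1 hh.1]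
    push Not at hv1
    obtain ⟨q, hq⟩ := hv1
    simp only [G]
    rw [Finset.prod_eq_zero (Finset.mem_univ q), ENNReal.ofReal_zero, zero_mul]
    exact indicator_of_notMem (by simpa using hq) _
  rw [indicator_of_mem (show v ∈ coneDomain h a b from ⟨hv1, hv2⟩)]
  simp only [H, G]
  rw [indicator_of_mem hv2]
  have hdet : (LinearMap.toContinuousLinearMap (Matrix.toLin' (coneJacobian h γ e v))).det =
      (coneJacobian h γ e v).det := by
    rw [LinearMap.det_toContinuousLinearMap, LinearMap.det_toLin']
  rw [hdet, det_coneJacobian, coneMap, conePoint_zero, abs_mul, Finset.abs_prod]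
  have hind : ∀ q, (Ioi (0 : ℝ)).indicator
      (fun s => Real.exp (-s) * s ^ (Sum.elim (fun _ => 0) (fun _ => 1) q : ℕ))
        (v (blockEquiv h (.inl q))) = Real.exp (-v (blockEquiv h (.inl q))) *
          v (blockEquiv h (.inl q)) ^ (Sum.elim (fun _ => 0) (fun _ => 1) q : ℕ) :=
    fun q => indicator_of_mem (mem_Ioi.2 (hv1 q)) _
  simp only [hind]
  have habs : ∀ j, |v (blockEquiv h (.inl (.inr j)))| = v (blockEquiv h (.inl (.inr j))) :=
    fun j => abs_of_pos (hv1 _)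
  simp only [habs]
  rw [Finset.prod_mul_distrib, ← Real.exp_sum, Finset.sum_neg_distrib, Fintype.prod_sum_type]
  simp only [Sum.elim_inl, Sum.elim_inr, pow_zero, pow_one, Finset.prod_const_one, one_mul]
  have hP : 0 ≤ ∏ j, v (blockEquiv h (.inl (.inr j))) :=
    Finset.prod_nonneg fun j _ => (hv1 _).le
  rw [← ENNReal.ofReal_mul (mul_nonneg hP (abs_nonneg _)),
    ← ENNReal.ofReal_mul (mul_nonneg (Real.exp_pos _).le hP)]
  congr 1
  ring

end

/-! ### From the open to the closed simplex, and removal of the absolute value. -/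

lemma convex_openSimplex (a b : ℝ) (k : ℕ) : Convex ℝ (openSimplex a b k) := by
  intro x hx y hy α β hα hβ hαβ
  refine ⟨fun i j hij => ?_, fun j => convex_Ioo a b (hx.2 j) (hy.2 j) hα hβ hαβ⟩
  have h1 := hx.1 hij
  have h2 := hy.1 hij
  simp only [Pi.add_apply, Pi.smul_apply, smul_eq_mul]
  rcases hα.eq_or_lt with rfl | hα'
  · have : β = 1 := by linarith
    subst this
    simpa using h2
  · exact add_lt_add_of_lt_of_le (mul_lt_mul_of_pos_left h1 hα')
      (mul_le_mul_of_nonneg_left h2.le hβ)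

lemma openSimplex_subset_orderedSimplex (a b : ℝ) (k : ℕ) :
    openSimplex a b k ⊆ orderedSimplex a b k :=
  fun _ hx => ⟨hx.1.monotone, fun j => Ioo_subset_Icc_self (hx.2 j)⟩

lemma orderedSimplex_subset_closure {a b : ℝ} (hab : a < b) (k : ℕ) :
    orderedSimplex a b k ⊆ closure (openSimplex a b k) := by
  intro x hx
  obtain ⟨y, hy⟩ := openSimplex_nonempty hab k
  have hcont : Continuous fun ε : ℝ => (1 - ε) • x + ε • y := by fun_prop
  have htend := (hcont.tendsto 0).mono_left (nhdsWithin_le_nhds (s := Ioi 0))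
  simp only [sub_zero, one_smul, zero_smul, add_zero] at htend
  refine mem_closure_of_tendsto htend ?_
  filter_upwards [Ioo_mem_nhdsGT (show (0 : ℝ) < 1 by norm_num)] with ε hε
  have h1 : 0 < 1 - ε := by linarith [hε.2]
  refine ⟨fun i j hij => ?_, fun j => ?_⟩
  · simp only [Pi.add_apply, Pi.smul_apply, smul_eq_mul]
    exact add_lt_add_of_le_of_lt (mul_le_mul_of_nonneg_left (hx.1 hij.le) h1.le)
      (mul_lt_mul_of_pos_left (hy.1 hij) hε.1)
  · simp only [Pi.add_apply, Pi.smul_apply, smul_eq_mul]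
    have hxj := hx.2 j
    have hyj := hy.2 j
    constructor
    · nlinarith [mul_le_mul_of_nonneg_left hxj.1 h1.le, mul_lt_mul_of_pos_left hyj.1 hε.1]
    · nlinarith [mul_le_mul_of_nonneg_left hxj.2 h1.le, mul_lt_mul_of_pos_left hyj.2 hε.1]

lemma orderedSimplex_ae_eq_openSimplex {a b : ℝ} (hab : a < b) (k : ℕ) :
    orderedSimplex a b k =ᵐ[volume] openSimplex a b k := by
  have h := closure_ae_eq_of_null_frontier ((convex_openSimplex a b k).addHaar_frontier volume)
  exact ((orderedSimplex_subset_closure hab k).eventuallyLE.trans h.le).antisymm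
    (openSimplex_subset_orderedSimplex a b k).eventuallyLE

section

variable {n p k : ℕ} {γ : ℝ → Fin n → ℝ} {a b : ℝ}

/-- Since e is increasing, its Vandermonde determinant is positive and the sign of the confluent
determinant is (-1)^(k(k-1)/2). Integrability follows from the boundedness of the hull. -/
theorem IsTotallyPosCurve.volume_convexHull (hγ : IsTotallyPosCurve γ a b)
    (hab : a < b) (hC : ContDiffOn ℝ 1 γ (Ioo a b)) (h : p + k + k = n + 1) {e : Fin p → ℝ}
    (he : ∀ i, e i = a ∨ e i = b) (hei : StrictMono e) :
    IntegrableOn (confluentDet h γ e) (orderedSimplex a b k) ∧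
      volume.real (convexHull ℝ (γ '' Icc a b)) =
        (-1 : ℝ) ^ (k * (k - 1) / 2) / (n.factorial : ℝ) *
          ∫ x in orderedSimplex a b k, confluentDet h γ e x := by
  have hSm := (isOpen_openSimplex a b k).measurableSet
  have hvol := hγ.factorial_mul_volume_convexHull hab hC h he hei.injective
  have hfin : volume (convexHull ℝ (γ '' Icc a b)) ≠ ⊤ :=
    (isBounded_convexHull.2 (isCompact_Icc.image_of_continuousOn
      hγ.isPosCurve.continuousOn).isBounded).measure_lt_top.ne
  have heI : ∀ i, e i ∈ Icc a b := fun i => by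
    rcases he i with hi | hi <;> rw [hi]
    exacts [left_mem_Icc.2 hab.le, right_mem_Icc.2 hab.le]
  have heI' : ∀ i, e i ∉ Ioo a b := fun i => by
    rcases he i with hi | hi <;> rw [hi] <;> simp
  have hV : 0 < (Matrix.vandermonde e).det := by
    rw [Matrix.det_vandermonde]
    exact Finset.prod_pos fun i _ => Finset.prod_pos fun j hj =>
      sub_pos.2 (hei (Finset.mem_Ioi.1 hj))
  have habs : ∀ x ∈ openSimplex a b k, |confluentDet h γ e x| =
      (-1) ^ (k * (k - 1) / 2) * confluentDet h γ e x := by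
    intro x hx
    have h1 := hγ.isPosCurve.confluentDet_mul_pos h heI hx.2
      (hei.injective.sumElim hx.1.injective fun i j hij => heI' i (hij ▸ hx.2 j))
    have h2 : 0 < (-1) ^ (k * (k - 1) / 2) * confluentDet h γ e x := by
      refine (pos_iff_pos_of_mul_pos (a := (Matrix.vandermonde e).det) ?_).1 hV
      calc (0 : ℝ) < _ := h1
        _ = _ := by ring
    rw [← abs_of_pos h2, abs_mul, abs_pow]
    simp
  have hint : IntegrableOn (confluentDet h γ e) (openSimplex a b k) := by
    refine ⟨(continuousOn_confluentDet hC h e).aestronglyMeasurable hSm, ?_⟩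
    rw [hasFiniteIntegral_iff_norm]
    simp only [Real.norm_eq_abs]
    rw [← hvol]
    exact (ENNReal.mul_ne_top (ENNReal.natCast_ne_top _) hfin).lt_top
  have hval : (n.factorial : ℝ) * volume.real (convexHull ℝ (γ '' Icc a b)) =
      (-1) ^ (k * (k - 1) / 2) * ∫ x in openSimplex a b k, confluentDet h γ e x := by
    have h1 := congrArg ENNReal.toReal hvol
    rw [ENNReal.toReal_mul, ENNReal.toReal_natCast,
      ← ofReal_integral_eq_lintegral_ofReal hint.abs
        (Filter.Eventually.of_forall fun x => abs_nonneg _),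
      ENNReal.toReal_ofReal (integral_nonneg fun x => abs_nonneg _)] at h1
    rw [measureReal_def, h1, ← integral_const_mul]
    exact setIntegral_congr_fun hSm fun x hx => habs x hx
  have hae := orderedSimplex_ae_eq_openSimplex hab k
  refine ⟨hint.congr_set_ae hae, ?_⟩
  rw [setIntegral_congr_set hae]
  have hn : (n.factorial : ℝ) ≠ 0 := by exact_mod_cast n.factorial_ne_zero
  field_simp
  linarith

end

/-! ### Elimination of the first column and the final formulas. -/

lemma det_eq_det_sub_of_apply_zero {m : ℕ} (M : Matrix (Fin (m + 1)) (Fin (m + 1)) ℝ)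
    (h0 : M 0 0 = 1) : M.det =
      (Matrix.of fun i j : Fin m => M i.succ j.succ - M 0 j.succ * M i.succ 0).det := by
  let B : Matrix (Fin (m + 1)) (Fin (m + 1)) ℝ :=
    Matrix.of fun i j => Fin.cases (M i 0) (fun j' => M i j'.succ - M 0 j'.succ * M i 0) j
  have hMB : M.transpose.det = B.transpose.det := by
    refine Matrix.det_eq_of_forall_row_eq_smul_add_const
      (Fin.cases 0 fun j' => M 0 j'.succ) 0 rfl fun i j => ?_
    refine Fin.cases ?_ (fun i => ?_) i
    · simp [B]
    · simp [B]
  rw [← Matrix.det_transpose M, hMB, Matrix.det_transpose,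
    det_eq_of_row_zero_eq_single B (by simp [B, h0]) (by simp [B, h0])]
  rfl

section

variable {n p k : ℕ}

lemma blockEquiv_inl_inl_val (h : p + k + k = n) (i : Fin p) :
    (blockEquiv h (.inl (.inl i)) : ℕ) = i := by simp [blockEquiv]

lemma blockEquiv_inl_inr_val (h : p + k + k = n) (i : Fin k) :
    (blockEquiv h (.inl (.inr i)) : ℕ) = p + i := by simp [blockEquiv]

lemma blockEquiv_inr_val (h : p + k + k = n) (i : Fin k) :
    (blockEquiv h (.inr i) : ℕ) = p + k + i := by simp [blockEquiv]

/-- Elimination of the first column, `(1, γ(t))`, from `confluentDet`. -/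
lemma confluentDet_eq_detCols {N : ℕ} (h : p + k + k = n + 1) (hN : N = n) (γ : ℝ → Fin n → ℝ)
    (e : Fin p → ℝ) (x : Fin k → ℝ) (w : Fin N → Fin n → ℝ) (c : Fin N → (Fin p ⊕ Fin k) ⊕ Fin k)
    (c₀ : Fin p ⊕ Fin k) (hc₀ : (blockEquiv h (.inl c₀) : ℕ) = 0)
    (hc : ∀ j, (blockEquiv h (c j) : ℕ) = j + 1)
    (hw : ∀ j i, w j i = confluentMatrix γ e x i.succ (c j) -
      confluentMatrix γ e x 0 (c j) * γ (Sum.elim e x c₀) i) :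
    confluentDet h γ e x = detCols hN w := by
  subst hN
  have h0 : (blockEquiv h).symm 0 = .inl c₀ := by
    rw [Equiv.symm_apply_eq]; exact Fin.ext (by simpa using hc₀.symm)
  have hs : ∀ j, (blockEquiv h).symm (Fin.succ j) = c j := fun j => by
    rw [Equiv.symm_apply_eq]; exact Fin.ext (by simpa using (hc j).symm)
  have hcol : ∀ i, confluentMatrix γ e x i (.inl c₀) = homCoord (γ (Sum.elim e x c₀)) i := by
    intro i
    rcases c₀ with q | q <;> rfl
  rw [confluentDet, det_eq_det_sub_of_apply_zero _ (by simp [h0, hcol]), detCols]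
  congr 1
  ext i j
  simp [h0, hs, hcol, hw]

lemma confluentDet_eq_chordTangent {ℓ : ℕ} (h : ℓ + ℓ = n) (h' : 1 + ℓ + ℓ = n + 1)
    (γ : ℝ → Fin n → ℝ) (r : ℝ) (x : Fin ℓ → ℝ) :
    confluentDet h' γ (fun _ : Fin 1 => r) x = detCols h (chordTangent γ r x) := by
  refine confluentDet_eq_detCols h' h γ _ x _
    (Fin.addCases (fun i => .inl (.inr i)) fun i => .inr i) (.inl 0) ?_ ?_ ?_
  · simp [blockEquiv_inl_inl_val]
  · intro j
    refine Fin.addCases (fun i => ?_) (fun i => ?_) j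
    · simp [blockEquiv_inl_inr_val, add_comm]
    · simp [blockEquiv_inr_val, -Fin.natAdd_eq_addNat]; ring
  · intro j i
    refine Fin.addCases (fun q => ?_) (fun q => ?_) j
    · simp [-Fin.natAdd_eq_addNat, chordTangent, confluentMatrix]
    · simp [-Fin.natAdd_eq_addNat, chordTangent, confluentMatrix]

lemma confluentDet_eq_endsChordTangent {m : ℕ} (h : m + m + 1 = n) (h' : 2 + m + m = n + 1)
    (γ : ℝ → Fin n → ℝ) (a b : ℝ) (x : Fin m → ℝ) :
    confluentDet h' γ ![a, b] x = detCols h (endsChordTangent γ a b x) := by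
  refine confluentDet_eq_detCols h' h γ _ x _
    (Fin.cons (.inl (.inl 1)) (Fin.addCases (fun i => .inl (.inr i)) fun i => .inr i))
    (.inl 0) ?_ ?_ ?_
  · simp [blockEquiv_inl_inl_val]
  · intro j
    refine Fin.cases ?_ (fun j => ?_) j
    · simp [blockEquiv_inl_inl_val]
    · refine Fin.addCases (fun i => ?_) (fun i => ?_) j
      · simp [blockEquiv_inl_inr_val]; ring
      · simp [blockEquiv_inr_val, -Fin.natAdd_eq_addNat]; ring
  · intro j i
    refine Fin.cases ?_ (fun j => ?_) j
    · simp [-Fin.natAdd_eq_addNat, endsChordTangent, confluentMatrix]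
    · refine Fin.addCases (fun q => ?_) (fun q => ?_) j
      · simp [-Fin.natAdd_eq_addNat, endsChordTangent, chordTangent, confluentMatrix]
      · simp [-Fin.natAdd_eq_addNat, endsChordTangent, chordTangent, confluentMatrix]

/-- Without fixed parameters the eliminated column is that of x₁, so the remaining point columns
become chords from γ(x₁). -/
lemma confluentDet_eq_firstChordTangent {m : ℕ} (h : m + (m + 1) = n)
    (h' : 0 + (m + 1) + (m + 1) = n + 1) (γ : ℝ → Fin n → ℝ) (e : Fin 0 → ℝ)
    (x : Fin (m + 1) → ℝ) :
    confluentDet h' γ e x = detCols h (firstChordTangent γ x) := by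
  refine confluentDet_eq_detCols h' h γ _ x _
    (Fin.addCases (fun i : Fin m => .inl (.inr i.succ)) fun i => .inr i) (.inr 0) ?_ ?_ ?_
  · simp [blockEquiv_inl_inr_val]
  · intro j
    refine Fin.addCases (fun i => ?_) (fun i => ?_) j
    · simp [blockEquiv_inl_inr_val]
    · simp [blockEquiv_inr_val, -Fin.natAdd_eq_addNat]; ring
  · intro j i
    refine Fin.addCases (fun q => ?_) (fun q => ?_) j
    · simp [firstChordTangent, confluentMatrix]
    · simp [firstChordTangent, confluentMatrix]

end

theorem corollary2p7 (n : ℕ) (hn : 1 ≤ n) (a b : ℝ) (hab : a < b) (γ : ℝ → (Fin n → ℝ))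
    (hcont : ContinuousOn γ (Icc a b)) (hdiff : ContDiffOn ℝ n γ (Ioo a b))
    (htors : HasTotallyPositiveTorsion γ a b) :
    -- `n = 2ℓ`
    (∀ (ℓ : ℕ) (h : ℓ + ℓ = n),
      (IntegrableOn (fun x => detCols h (chordTangent γ a x)) (orderedSimplex a b ℓ) ∧
        volume.real (convexHull ℝ (γ '' Icc a b)) =
          (-1 : ℝ) ^ (ℓ * (ℓ - 1) / 2) / (Nat.factorial (2 * ℓ) : ℝ) *
            ∫ x in orderedSimplex a b ℓ, detCols h (chordTangent γ a x)) ∧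
      (IntegrableOn (fun x => detCols h (chordTangent γ b x)) (orderedSimplex a b ℓ) ∧
        volume.real (convexHull ℝ (γ '' Icc a b)) =
          (-1 : ℝ) ^ (ℓ * (ℓ - 1) / 2) / (Nat.factorial (2 * ℓ) : ℝ) *
            ∫ x in orderedSimplex a b ℓ, detCols h (chordTangent γ b x))) ∧
    -- `n = 2ℓ - 1`, with `ℓ = m + 1`
    (∀ (m : ℕ) (h : m + m + 1 = n),
      (IntegrableOn (fun x => detCols h (endsChordTangent γ a b x)) (orderedSimplex a b m) ∧
        volume.real (convexHull ℝ (γ '' Icc a b)) =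
          (-1 : ℝ) ^ (m * (m - 1) / 2) / (Nat.factorial (2 * m + 1) : ℝ) *
            ∫ x in orderedSimplex a b m, detCols h (endsChordTangent γ a b x)) ∧
      (IntegrableOn (fun x => detCols h (firstChordTangent γ x)) (orderedSimplex a b (m + 1)) ∧
        volume.real (convexHull ℝ (γ '' Icc a b)) =
          (-1 : ℝ) ^ ((m + 1) * m / 2) / (Nat.factorial (2 * m + 1) : ℝ) *
            ∫ x in orderedSimplex a b (m + 1), detCols h (firstChordTangent γ x))) := by
  have hγ := htors.isTotallyPosCurve hn hcont hdiff
  have hC : ContDiffOn ℝ 1 γ (Ioo a b) := hdiff.of_le (by exact_mod_cast hn)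
  -- The relation p + 2k = n + 1 allows p = 1 for even n, and p = 2 or p = 0 for odd n.
  refine ⟨fun ℓ h => ?_, fun m h => ?_⟩
  · have h' : 1 + ℓ + ℓ = n + 1 := by omega
    have hfact : 2 * ℓ = n := by omega
    have hr : ∀ r : ℝ, r = a ∨ r = b →
        IntegrableOn (fun x => detCols h (chordTangent γ r x)) (orderedSimplex a b ℓ) ∧
        volume.real (convexHull ℝ (γ '' Icc a b)) =
          (-1 : ℝ) ^ (ℓ * (ℓ - 1) / 2) / (Nat.factorial (2 * ℓ) : ℝ) *
            ∫ x in orderedSimplex a b ℓ, detCols h (chordTangent γ r x) := by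
      intro r hr
      have key := hγ.volume_convexHull hab hC h' (e := fun _ : Fin 1 => r) (fun _ => hr)
        (Subsingleton.strictMono _)
      simp only [← confluentDet_eq_chordTangent h h', hfact]
      exact key
    exact ⟨hr a (Or.inl rfl), hr b (Or.inr rfl)⟩
  · have hfact : 2 * m + 1 = n := by omega
    constructor
    · have h' : 2 + m + m = n + 1 := by omega
      have key := hγ.volume_convexHull hab hC h' (e := ![a, b])
        (fun i => by fin_cases i <;> simp)
        (fun i j hij => by fin_cases i <;> fin_cases j <;> simp_all)
      simp only [← confluentDet_eq_endsChordTangent h h', hfact]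
      exact key
    · have h' : 0 + (m + 1) + (m + 1) = n + 1 := by omega
      have key := hγ.volume_convexHull hab hC h' (e := fun i : Fin 0 => i.elim0)
        (fun i => i.elim0) (fun i => i.elim0)
      simp only [← confluentDet_eq_firstChordTangent h h' γ (fun i : Fin 0 => i.elim0), hfact]
      exact key
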